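/- Let $\{X_n\}_{n\ge 0}$ be a time-homogeneous Markov chain on a measurable space $(\mathbb S,\mathcal S)$ with transition kernel $P$, and let $\varphi$ be a ($\sigma$-finite) maximal irreducibility measure of $P$. Let $f:\mathbb S\to\mathbb R$ and $h:\mathbb S\to[0,\infty)$ be measurable, $S_n=f(X_1)+\dots+f(X_n)$, $S^{(h)}_n=h(X_1)+\dots+h(X_n)$. Fix $a>0$ and let $C=\{x: h(x)\le a\}$. Assume the minorization condition: $\varphi(C)>0$, and there are $\delta>0$ and a probability measure $\nu$ with $\nu(C)>0$ such that $$\delta\,\mathbf 1_C(x)\,\nu(E)\le P(x,E)\qquad\forall x\in\mathbb S,\ E\in\mathcal S ,$$ where (after the usual truncation of $\nu$) $\nu$ is concentrated on $C\cap\{|f|\le b\}$ for some finite $b$. Notation. For $\boldsymbol\alpha=(\alpha,\beta)\in\mathbb R^2$ and $\varepsilon\ge0$ put $P^{(\varepsilon)}(x,E)=P(x,E)+\varepsilon\nu(E)$, $\hat P^{(\varepsilon)}_{\boldsymbol\alpha}(x,E)=\int_E e^{\alpha f(y)+\beta h(y)}P^{(\varepsilon)}(x,dy)$, and $\hat\nu^{(\boldsymbol\alpha)}(E)=\int_E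 e^{\alpha f+\beta h}\,d\nu$. Let $$\boldsymbol\Lambda_x(\boldsymbol\alpha)=\limsup_{n\to\infty}\tfrac1n\log\mathbb E_x\big[e^{\alpha S_n+\beta S_n^{(h)}}\big],\qquad \boldsymbol\Lambda_x^{(\varepsilon)}(\boldsymbol\alpha)=\limsup_{n\to\infty}\tfrac1n\log(\hat P^{(\varepsilon)}_{\boldsymbol\alpha})^n(x,\mathbb S),$$ and let $\boldsymbol\Lambda_{\nu}(\boldsymbol\alpha)$ be the first quantity for the chain with $X_0\sim\nu$. Let $\mathfrak D_{\boldsymbol\Lambda}$ be the set of $\boldsymbol\alpha$ with $\boldsymbol\Lambda_x(\boldsymbol\alpha)<\infty$ for $\varphi$-a.a. $x$, and let $\mathbb E^{(1)}_\nu$ be the expectation when $X_1\sim\nu$. For a kernel $K$, the convergence parameter $R(K)$ is the critical value of $r\ge0$ such that for $r>R(K)$ one has $\sum_n r^nK^n(x,A)=\infty$ for all $x\in\mathbb S$ and all $A\in\mathcal S$ with $\varphi(A)>0$, while for $r<R(K)$ this fails; $K$ is $r$-recurrent if $\sum_n r^nK^n(x,A)=\infty$ for all $x$ and all $A$ with $\varphi(A)>0$.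 Let $\boldsymbol\theta^{(\varepsilon)}(\boldsymbol\alpha)=1/R(\hat P^{(\varepsilon)}_{\boldsymbol\alpha})\in[0,\infty]$ and $\boldsymbol\Theta^{(\varepsilon)}=\log\boldsymbol\theta^{(\varepsilon)}$. Quantities with a scalar argument $\alpha\in\mathbb R$ are those with $\boldsymbol\alpha=(\alpha,0)$ and are written $\Lambda,\ \theta^{(\varepsilon)},\ \hat P^{(\varepsilon)}_\alpha$, etc. Finally, let $$r^{(\varepsilon)}_\alpha=\sum_{n\ge0}(\theta^{(\varepsilon)}(\alpha))^{-n-1}\big(\hat P^{(\varepsilon)}_\alpha-\delta\mathbf 1_C\otimes\hat\nu^{(\alpha)}\big)^n\,\delta\mathbf 1_C,\qquad Q^{(\varepsilon)}_\alpha(x,E)=\int_E\frac{e^{\alpha f(y)}r^{(\varepsilon)}_\alpha(y)}{\theta^{(\varepsilon)}(\alpha)\,r^{(\varepsilon)}_\alpha(x)}\,P^{(\varepsilon)}(x,dy).$$ Then: (i) For every $\boldsymbol\alpha\in\mathfrak D_{\boldsymbol\Lambda}$, $\boldsymbol\Lambda_x(\boldsymbol\alpha)=\boldsymbol\Lambda_{\nu}(\boldsymbol\alpha)$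 for $\varphi$-a.a. $x$ (so $\boldsymbol\Lambda$ does not depend on the initial state), and for all $N\ge1$, $\ \sup_{n\ge N}\frac1n\log\mathbb E^{(1)}_{\nu}\big[e^{\alpha S_n+\beta S_n^{(h)}}\big]<\infty$. (ii) For every $\varepsilon\ge0$ the extended-real-valued function $\boldsymbol\Theta^{(\varepsilon)}$ is convex on $\mathbb R^2$, and for every $\boldsymbol\alpha\in\mathfrak D_{\boldsymbol\Lambda}$, $\boldsymbol\Theta^{(\varepsilon)}(\boldsymbol\alpha)\le\boldsymbol\Lambda_x^{(\varepsilon)}(\boldsymbol\alpha)$ for $\varphi$-a.a. $x$. (iii) For every $\boldsymbol\alpha\in\mathfrak D_{\boldsymbol\Lambda}$ and $\varphi$-a.a. $x$, $\ \lim_{\varepsilon\downarrow0}\boldsymbol\Lambda_x^{(\varepsilon)}(\boldsymbol\alpha)=\boldsymbol\Lambda_x(\boldsymbol\alpha)$. (iv) For every $\alpha\in\mathfrak D_{\Lambda}$ and $\varepsilon\ge0$, for $\varphi$-a.a. $x$ one has $0<r^{(\varepsilon)}_\alpha(x)<\infty$ and $Q^{(\varepsilon)}_\alpha(x,\mathbb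 S)\le1$. If moreover $\hat P^{(\varepsilon)}_\alpha$ is $(\theta^{(\varepsilon)}(\alpha))^{-1}$-recurrent, then $Q^{(\varepsilon)}_\alpha(x,\cdot)$ is a probability measure for $\varphi$-a.a. $x$. -/

import Mathlib

open MeasureTheory ProbabilityTheory Filter Topology
open scoped ENNReal NNReal

namespace MarkovAdditive

/-- `φ` is a maximal irreducibility measure of the Markov kernel `P`: the chain is
`φ`-irreducible and every (σ-finite) irreducibility measure is absolutely continuous
with respect to `φ`. -/
def IsMaximalIrreducibilityMeasure {S : Type*} [MeasurableSpace S]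
    (φ : Measure S) (P : Kernel S S) : Prop :=
  Kernel.IsIrreducible φ P ∧
    ∀ ψ : Measure S, SigmaFinite ψ → Kernel.IsIrreducible ψ P → ψ ≪ φ

/-- The level set `{x | h x ≤ a}`. -/
def levelSet {S : Type*} (h : S → ℝ) (a : ℝ) : Set S := {x | h x ≤ a}

/-- The exponent function `x ↦ α f(x) + β h(x)` attached to `(α, β) ∈ ℝ²`. -/
def expo {S : Type*} (f h : S → ℝ) (α : ℝ × ℝ) : S → ℝ := fun x => α.1 * f x + α.2 * h x

/-- The law on `S^ℕ` of the time-homogeneous Markov chain `X₀, X₁, …` with transition kernel `P`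
and initial distribution `μ`. -/
noncomputable def chainLaw {S : Type*} [MeasurableSpace S] (P : Kernel S S) [IsMarkovKernel P]
    (μ : Measure S) : Measure (ℕ → S) :=
  Kernel.trajMeasure (X := fun _ => S) μ
    (fun n => P.comap (fun w : (Finset.Iic n → S) => w ⟨n, Finset.mem_Iic.2 le_rfl⟩)
      (measurable_pi_apply _))

/-- `E_μ[exp(g(X₁) + ⋯ + g(Xₙ))]`, where `X₀` has distribution `μ`. -/
noncomputable def expMoment {S : Type*} [MeasurableSpace S] (P : Kernel S S) [IsMarkovKernel P]
    (g : S → ℝ) (μ : Measure S) (n : ℕ) : ℝ≥0∞ :=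
  ∫⁻ X, ENNReal.ofReal (Real.exp (∑ i ∈ Finset.Icc 1 n, g (X i))) ∂(chainLaw P μ)

/-- `E⁽¹⁾_ν[exp(g(X₁) + ⋯ + g(Xₙ))]`, where regeneration occurs at time one, that is, `X₁` has
distribution `ν`. Here `Y i = X (i + 1)` is the chain observed from time one on. -/
noncomputable def expMomentRegenOne {S : Type*} [MeasurableSpace S] (P : Kernel S S)
    [IsMarkovKernel P] (g : S → ℝ) (ν : Measure S) (n : ℕ) : ℝ≥0∞ :=
  ∫⁻ Y, ENNReal.ofReal (Real.exp (∑ i ∈ Finset.range n, g (Y i))) ∂(chainLaw P ν)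

/-- The Gärtner–Ellis limit `limsup (1/n) log E_μ[exp(g(X₁) + ⋯ + g(Xₙ))]` of the chain with
initial distribution `μ`. -/
noncomputable def gartnerEllis {S : Type*} [MeasurableSpace S] (P : Kernel S S) [IsMarkovKernel P]
    (g : S → ℝ) (μ : Measure S) : EReal :=
  limsup (fun n : ℕ => ENNReal.log (expMoment P g μ n) / (n : EReal)) atTop

/-- The exponent `g` lies in the domain of the Gärtner–Ellis limit: the limit is `< ∞` for
`φ`-almost all initial states. -/
def InDomain {S : Type*} [MeasurableSpace S] (P : Kernel S S) [IsMarkovKernel P]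
    (φ : Measure S) (g : S → ℝ) : Prop :=
  ∀ᵐ x ∂φ, gartnerEllis P g (Measure.dirac x) < ⊤

/-- The transform measure `E ↦ ∫_E e^{g(y)} μ(dy)`. -/
noncomputable def hatMeasure {S : Type*} [MeasurableSpace S] (g : S → ℝ) (μ : Measure S) :
    Measure S :=
  μ.withDensity (fun y => ENNReal.ofReal (Real.exp (g y)))

/-- The transform kernel `(x, E) ↦ ∫_E e^{g(y)} K(x, dy)`. -/
noncomputable def hatKernel {S : Type*} [MeasurableSpace S] (g : S → ℝ) (K : Kernel S S)
    [IsSFiniteKernel K] : Kernel S S :=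
  K.withDensity (fun _ y => ENNReal.ofReal (Real.exp (g y)))

/-- The perturbed kernel `P^{(ε)}(x, E) = P(x, E) + ε ν(E)`. -/
noncomputable def perturbed {S : Type*} [MeasurableSpace S] (P : Kernel S S) (ν : Measure S)
    (ε : ℝ≥0) : Kernel S S :=
  P + Kernel.const S (ε • ν)

instance {S : Type*} [MeasurableSpace S] (P : Kernel S S) [IsMarkovKernel P] (ν : Measure S)
    [IsProbabilityMeasure ν] (ε : ℝ≥0) : IsFiniteKernel (perturbed P ν ε) := by
  unfold perturbed
  infer_instance

/-- The transform `P̂^{(ε)}` of the perturbed kernel. -/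
noncomputable def hatPerturbed {S : Type*} [MeasurableSpace S] (P : Kernel S S) [IsMarkovKernel P]
    (ν : Measure S) [IsProbabilityMeasure ν] (ε : ℝ≥0) (g : S → ℝ) : Kernel S S :=
  hatKernel g (perturbed P ν ε)

/-- `Λ^{(ε)}`: `limsup (1/n) log (P̂^{(ε)})ⁿ(x, S)`. -/
noncomputable def perturbedLimit {S : Type*} [MeasurableSpace S] (P : Kernel S S)
    [IsMarkovKernel P] (ν : Measure S) [IsProbabilityMeasure ν] (ε : ℝ≥0) (g : S → ℝ) (x : S) :
    EReal :=
  limsup (fun n : ℕ => ENNReal.log ((hatPerturbed P ν ε g ^ n) x Set.univ) / (n : EReal)) atTop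

/-- The potential `∑ₙ rⁿ Kⁿ(x, A)`. -/
noncomputable def potential {S : Type*} [MeasurableSpace S] (K : Kernel S S) (r : ℝ≥0∞) (x : S)
    (A : Set S) : ℝ≥0∞ :=
  ∑' n : ℕ, r ^ n * (K ^ n) x A

/-- The convergence parameter of an irreducible nonnegative kernel with (maximal) irreducibility
measure `φ`: the critical `R` such that for `r > R` the potential `∑ₙ rⁿ Kⁿ(x, A)` is infinite for
all states `x` and all `φ`-positive sets `A`, whereas for `r < R` it is not. -/
noncomputable def convergenceParameter {S : Type*} [MeasurableSpace S] (φ : Measure S)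
    (K : Kernel S S) : ℝ≥0∞ :=
  sSup {r : ℝ≥0∞ | ∃ x : S, ∃ A : Set S, MeasurableSet A ∧ 0 < φ A ∧ potential K r x A < ⊤}

/-- `K` is `r`-recurrent: `∑ₙ rⁿ Kⁿ(x, A) = ∞` for all `x` and all `φ`-positive `A`. -/
def IsRecurrentAt {S : Type*} [MeasurableSpace S] (φ : Measure S) (K : Kernel S S) (r : ℝ≥0∞) :
    Prop :=
  ∀ x : S, ∀ A : Set S, MeasurableSet A → 0 < φ A → potential K r x A = ⊤

/-- `θ^{(ε)}`, the reciprocal of the convergence parameter of `P̂^{(ε)}`. -/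
noncomputable def theta {S : Type*} [MeasurableSpace S] (φ : Measure S) (P : Kernel S S)
    [IsMarkovKernel P] (ν : Measure S) [IsProbabilityMeasure ν] (ε : ℝ≥0) (g : S → ℝ) : ℝ≥0∞ :=
  (convergenceParameter φ (hatPerturbed P ν ε g))⁻¹

/-- `Θ^{(ε)} = log θ^{(ε)}`. -/
noncomputable def logTheta {S : Type*} [MeasurableSpace S] (φ : Measure S) (P : Kernel S S)
    [IsMarkovKernel P] (ν : Measure S) [IsProbabilityMeasure ν] (ε : ℝ≥0) (g : S → ℝ) : EReal :=
  ENNReal.log (theta φ P ν ε g)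

/-- The measure `(P̂^{(ε)} - δ 1_C ⊗ ν̂)(x, ·)`. -/
noncomputable def residual {S : Type*} [MeasurableSpace S] (P : Kernel S S) [IsMarkovKernel P]
    (ν : Measure S) [IsProbabilityMeasure ν] (δ : ℝ≥0) (C : Set S) (ε : ℝ≥0) (g : S → ℝ) (x : S) :
    Measure S :=
  hatPerturbed P ν ε g x - C.indicator (fun _ => (δ : ℝ≥0∞)) x • hatMeasure g ν

/-- The kernel `P̂^{(ε)} - δ 1_C ⊗ ν̂` acting on nonnegative functions. -/
noncomputable def residualOp {S : Type*} [MeasurableSpace S] (P : Kernel S S) [IsMarkovKernel P]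
    (ν : Measure S) [IsProbabilityMeasure ν] (δ : ℝ≥0) (C : Set S) (ε : ℝ≥0) (g : S → ℝ)
    (u : S → ℝ≥0∞) : S → ℝ≥0∞ :=
  fun x => ∫⁻ y, u y ∂(residual P ν δ C ε g x)

/-- `r^{(ε)} = ∑ₙ (θ^{(ε)})^{-n-1} (P̂^{(ε)} - δ 1_C ⊗ ν̂)ⁿ δ 1_C`. -/
noncomputable def rFun {S : Type*} [MeasurableSpace S] (φ : Measure S) (P : Kernel S S)
    [IsMarkovKernel P] (ν : Measure S) [IsProbabilityMeasure ν] (δ : ℝ≥0) (C : Set S) (ε : ℝ≥0)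
    (g : S → ℝ) (x : S) : ℝ≥0∞ :=
  ∑' n : ℕ, (theta φ P ν ε g)⁻¹ ^ (n + 1) *
    ((residualOp P ν δ C ε g)^[n] (C.indicator (fun _ => (δ : ℝ≥0∞)))) x

/-- The shifted kernel
`Q^{(ε)}(x, E) = ∫_E e^{g(y)} r^{(ε)}(y) / (θ^{(ε)} r^{(ε)}(x)) P^{(ε)}(x, dy)`. -/
noncomputable def shifted {S : Type*} [MeasurableSpace S] (φ : Measure S) (P : Kernel S S)
    [IsMarkovKernel P] (ν : Measure S) [IsProbabilityMeasure ν] (δ : ℝ≥0) (C : Set S) (ε : ℝ≥0)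
    (g : S → ℝ) (x : S) : Measure S :=
  (perturbed P ν ε x).withDensity (fun y =>
    ENNReal.ofReal (Real.exp (g y)) * rFun φ P ν δ C ε g y /
      (theta φ P ν ε g * rFun φ P ν δ C ε g x))

end MarkovAdditive

/-!
Everything is read off the Green functions `G_r u = ∑ₙ rⁿ Kⁿ u` of the transform kernels `K`, each
of which inherits irreducibility and the minorization `δ 1_C ⊗ ν̂ ≤ K` from `P`. The basic tool is
`green_le_of_supersolution`: the Green function is the least `w ≥ 0` with `u + r K w ≤ w`. No
kernel is assumed finite, so all estimates are comparisons of series in `[0, ∞]`.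

A chain with any initial measure regenerates from `ν` with positive probability. Hence, if its
exponential moments grow at a rate below `log (1/r)`, then `ν̂ (G_r 1) < ∞`
(`Minorized.lintegral_green_lt_top_of_growthRate_lt`). Conversely `ν̂ (G_r 1) < ∞` forces
`G_r 1 < ∞` at `φ`-almost every state, because the infinity set of a superharmonic function which
is integrable for `ν̂` cannot be reached (`Minorized.ae_lt_top_of_superharmonic`). So the growth
rate at almost every state, and the one from `ν`, are minus the logarithm of one critical radius
(`ae_gartnerEllis_eq`), and the moments from `ν̂` are bounded by a geometric sequence.

If `r ε ν̂ (G_r 1) ≤ 1/2`, then `2 G_r 1` is a supersolution for `P̂ + ε ⊗ ν̂`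
(`green_hatPerturbed_le`). This gives continuity of the growth rates as `ε ↓ 0`, and, as `r` may be
taken small, positivity of the convergence parameter for every `ε`.

The convergence parameter `R` is governed by the potential of the single set `C` integrated
against `ν̂` (`Minorized.lintegral_green_lt_top_of_potential_lt_top`). Two transforms of `ν` are
equivalent measures, so below the two convergence parameters the potentials of `C` are finite at a
common state, where Hölder's inequality for `Kⁿ` yields log-convexity (`logTheta_convex`).

Finally write `K = T + δ 1_C ⊗ ν̂` and let `r = ∑ₙ R^{n+1} Tⁿ δ 1_C`. Comparing Green functions of
`K` and `T` at radii `s < R` and letting `s ↑ R` gives `q := ν̂ r ≤ 1`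
(`Minorized.mul_lintegral_green_le_one`). Since `r + R δ 1_C q = R δ 1_C + R K r`, the function `r`
is `R`-superharmonic, whence it is positive everywhere, finite almost everywhere, and the shifted
kernel is substochastic. If `q < 1`, a multiple of `r` would bound the potential of `C`, so
recurrence forces `q = 1` and `R K r = r`.
-/

namespace MarkovAdditive

variable {S : Type*} [MeasurableSpace S]

/-! ### Powers of a kernel and Green functions -/

lemma lintegral_pow_zero (K : Kernel S S) {u : S → ℝ≥0∞} (hu : Measurable u) (x : S) :
    ∫⁻ y, u y ∂(K ^ 0) x = u x := by
  rw [pow_zero, show (1 : Kernel S S) = Kernel.id from rfl, Kernel.id_apply, lintegral_dirac' _ hu]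

lemma lintegral_pow_add (K : Kernel S S) (m n : ℕ) {u : S → ℝ≥0∞} (hu : Measurable u) (x : S) :
    ∫⁻ y, u y ∂(K ^ (m + n)) x = ∫⁻ y, ∫⁻ z, u z ∂(K ^ n) y ∂(K ^ m) x := by
  rw [add_comm, Kernel.pow_add, Kernel.lintegral_comp _ _ _ hu]

lemma lintegral_pow_succ (K : Kernel S S) (n : ℕ) {u : S → ℝ≥0∞} (hu : Measurable u) (x : S) :
    ∫⁻ y, u y ∂(K ^ (n + 1)) x = ∫⁻ y, ∫⁻ z, u z ∂(K ^ n) y ∂K x := by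
  rw [add_comm, lintegral_pow_add K 1 n hu, pow_one]

/-- The Green function `∑ₙ rⁿ Kⁿ u` of the kernel `K` with source `u`. -/
noncomputable def green (K : Kernel S S) (r : ℝ≥0∞) (u : S → ℝ≥0∞) (x : S) : ℝ≥0∞ :=
  ∑' n : ℕ, r ^ n * ∫⁻ y, u y ∂(K ^ n) x

lemma measurable_green (K : Kernel S S) (r : ℝ≥0∞) {u : S → ℝ≥0∞} (hu : Measurable u) :
    Measurable (green K r u) :=
  Measurable.tsum fun _ => hu.lintegral_kernel.const_mul _

lemma potential_eq_green (K : Kernel S S) (r : ℝ≥0∞) (x : S) {A : Set S} (hA : MeasurableSet A) :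
    potential K r x A = green K r (A.indicator 1) x := by
  simp only [potential, green, lintegral_indicator_one hA]

lemma lintegral_green (K : Kernel S S) (r : ℝ≥0∞) {u : S → ℝ≥0∞} (hu : Measurable u)
    (m : Measure S) :
    ∫⁻ x, green K r u x ∂m = ∑' n : ℕ, r ^ n * ∫⁻ x, ∫⁻ y, u y ∂(K ^ n) x ∂m := by
  unfold green
  rw [lintegral_tsum fun _ => (hu.lintegral_kernel.const_mul _).aemeasurable]
  exact tsum_congr fun n => lintegral_const_mul _ hu.lintegral_kernel

lemma green_eq (K : Kernel S S) (r : ℝ≥0∞) {u : S → ℝ≥0∞} (hu : Measurable u) (x : S) :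
    green K r u x = u x + r * ∫⁻ y, green K r u y ∂K x := by
  rw [lintegral_green K r hu, green, tsum_eq_zero_add' ENNReal.summable, pow_zero, one_mul,
    lintegral_pow_zero K hu, ← ENNReal.tsum_mul_left]
  congr 1
  refine tsum_congr fun n => ?_
  rw [lintegral_pow_succ K n hu, pow_succ']
  ring

/-- The Green function is the least supersolution of `w = u + r K w`. -/
lemma green_le_of_supersolution (K : Kernel S S) (r : ℝ≥0∞) {u w : S → ℝ≥0∞} (hu : Measurable u)
    (hw : ∀ x, u x + r * ∫⁻ y, w y ∂K x ≤ w x) (x : S) : green K r u x ≤ w x := by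
  refine ENNReal.tsum_le_of_sum_range_le fun N => ?_
  induction N generalizing x with
  | zero => simp
  | succ N ih =>
    refine le_trans ?_ (hw x)
    rw [Finset.sum_range_succ', pow_zero, one_mul, lintegral_pow_zero K hu, add_comm]
    gcongr
    calc ∑ n ∈ Finset.range N, r ^ (n + 1) * ∫⁻ y, u y ∂(K ^ (n + 1)) x
        = r * ∫⁻ y, ∑ n ∈ Finset.range N, r ^ n * ∫⁻ z, u z ∂(K ^ n) y ∂K x := by
          rw [lintegral_finsetSum _ fun n _ => hu.lintegral_kernel.const_mul _, Finset.mul_sum]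
          refine Finset.sum_congr rfl fun n _ => ?_
          rw [lintegral_pow_succ K n hu, lintegral_const_mul _ hu.lintegral_kernel, pow_succ']
          ring
      _ ≤ r * ∫⁻ y, w y ∂K x := by
          gcongr with y
          exact ih y

lemma pow_mul_lintegral_le_of_superharmonic (K : Kernel S S) (r : ℝ≥0∞) {v : S → ℝ≥0∞}
    (hv : Measurable v) (h : ∀ x, r * ∫⁻ y, v y ∂K x ≤ v x) (n : ℕ) (x : S) :
    r ^ n * ∫⁻ y, v y ∂(K ^ n) x ≤ v x := by
  induction n generalizing x with
  | zero => rw [pow_zero, one_mul, lintegral_pow_zero K hv]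
  | succ n ih =>
    refine le_trans ?_ (h x)
    rw [lintegral_pow_succ K n hv, pow_succ', mul_assoc,
      ← lintegral_const_mul _ hv.lintegral_kernel]
    gcongr with y
    exact ih y

lemma green_superharmonic (K : Kernel S S) (r : ℝ≥0∞) {u : S → ℝ≥0∞} (hu : Measurable u) (x : S) :
    r * ∫⁻ y, green K r u y ∂K x ≤ green K r u x := by
  rw [green_eq K r hu x]
  exact le_add_self

lemma green_add_const_mul (K : Kernel S S) (r κ : ℝ≥0∞) {u v : S → ℝ≥0∞} (hu : Measurable u)
    (hv : Measurable v) (x : S) :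
    green K r (fun y => u y + κ * v y) x = green K r u x + κ * green K r v x := by
  unfold green
  rw [← ENNReal.tsum_mul_left, ← ENNReal.tsum_add]
  refine tsum_congr fun n => ?_
  rw [lintegral_add_left hu, lintegral_const_mul _ hv]
  ring

lemma lintegral_pow_le_of_kernel_le {K L : Kernel S S} (h : ∀ x, K x ≤ L x) {u : S → ℝ≥0∞}
    (hu : Measurable u) (n : ℕ) (x : S) :
    ∫⁻ y, u y ∂(K ^ n) x ≤ ∫⁻ y, u y ∂(L ^ n) x := by
  induction n generalizing x with
  | zero => simp
  | succ n ih =>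
    rw [lintegral_pow_succ K n hu, lintegral_pow_succ L n hu]
    exact lintegral_mono' (h x) ih

lemma pow_absolutelyContinuous {K L : Kernel S S} (h : ∀ x, K x ≪ L x) (n : ℕ) (x : S) :
    (K ^ n) x ≪ (L ^ n) x := by
  induction n generalizing x with
  | zero => simpa using Measure.AbsolutelyContinuous.rfl
  | succ n ih =>
    refine Measure.AbsolutelyContinuous.mk fun A hA hz => ?_
    rw [add_comm, Kernel.pow_add_apply_eq_lintegral _ _ _ _ hA, pow_one,
      lintegral_eq_zero_iff (Kernel.measurable_coe _ hA)] at hz ⊢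
    filter_upwards [(h x).ae_le hz] with y hy using ih y hy

/-! ### Exponential growth rates -/

/-- The exponential growth rate `limsup (1/n) log wₙ`. -/
noncomputable def growthRate (w : ℕ → ℝ≥0∞) : EReal :=
  limsup (fun n : ℕ => ENNReal.log (w n) / (n : EReal)) atTop

lemma log_div_le_log_iff {w d : ℝ≥0∞} {n : ℕ} (hn : 0 < n) :
    ENNReal.log w / (n : EReal) ≤ ENNReal.log d ↔ w ≤ d ^ n := by
  rw [EReal.div_le_iff_le_mul (by exact_mod_cast hn) (EReal.natCast_ne_top n), ← ENNReal.log_pow,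
    ENNReal.log_le_log_iff]

lemma growthRate_mono {w w' : ℕ → ℝ≥0∞} (h : ∀ n, w n ≤ w' n) : growthRate w ≤ growthRate w' := by
  refine limsup_le_limsup (Eventually.of_forall fun n => ?_)
  exact EReal.div_le_div_right_of_nonneg (by positivity) (ENNReal.log_le_log (h n))

/-- Below the radius `exp (-growthRate w)` the power series of `w` has a finite tail. A tail
is all one can ask for, as the first few `w n` may be infinite. -/
lemma exists_tail_lt_top {w : ℕ → ℝ≥0∞} {r : ℝ≥0∞} (h : growthRate w < ENNReal.log r⁻¹) :
    ∃ N, ∑' k : ℕ, r ^ (N + k) * w (N + k) < ⊤ := by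
  obtain ⟨e, he, he'⟩ := exists_between h
  obtain ⟨d, rfl⟩ := ENNReal.log_surjective e
  rw [ENNReal.log_lt_log_iff] at he'
  obtain ⟨N, hN⟩ := eventually_atTop.1
    ((eventually_lt_of_limsup_lt he).and (eventually_gt_atTop 0))
  have hrd : r * d < 1 := by
    rcases eq_or_ne r 0 with rfl | hr
    · simp
    have hr' : r ≠ ⊤ := by rintro rfl; simp at he'
    calc r * d < r * r⁻¹ := ENNReal.mul_lt_mul_right hr hr' he'
      _ = 1 := ENNReal.mul_inv_cancel hr hr'
  refine ⟨N, lt_of_le_of_lt (ENNReal.tsum_le_tsum (g := fun k => (r * d) ^ k) fun k => ?_) ?_⟩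
  · have hk := hN (N + k) (Nat.le_add_right _ _)
    have := (log_div_le_log_iff hk.2).1 hk.1.le
    calc r ^ (N + k) * w (N + k) ≤ r ^ (N + k) * d ^ (N + k) := by gcongr
      _ = (r * d) ^ (N + k) := (mul_pow _ _ _).symm
      _ ≤ (r * d) ^ k := pow_le_pow_of_le_one zero_le hrd.le (Nat.le_add_left _ _)
  · rw [ENNReal.tsum_geometric, ENNReal.inv_lt_top]
    exact tsub_pos_of_lt hrd

lemma growthRate_le_of_tsum_lt_top {w : ℕ → ℝ≥0∞} {r : ℝ≥0∞} (hr : r ≠ 0) (hr' : r ≠ ⊤)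
    (h : ∑' n : ℕ, r ^ n * w n < ⊤) : growthRate w ≤ ENNReal.log r⁻¹ := by
  refine le_of_forall_gt_imp_ge_of_dense fun e he => ?_
  obtain ⟨d, rfl⟩ := ENNReal.log_surjective e
  rw [ENNReal.log_lt_log_iff] at he
  have hrd : 1 < r * d := by
    calc 1 = r * r⁻¹ := (ENNReal.mul_inv_cancel hr hr').symm
      _ < r * d := ENNReal.mul_lt_mul_right hr hr' he
  have hev := (ENNReal.tendsto_pow_atTop_nhds_top_iff.2 hrd).eventually (eventually_gt_nhds h)
  refine limsup_le_of_le (h := ?_)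
  filter_upwards [hev, eventually_gt_atTop 0] with n hn hn0
  rw [log_div_le_log_iff hn0]
  have h1 : r ^ n * w n ≤ r ^ n * d ^ n := by
    rw [← mul_pow]
    exact (ENNReal.le_tsum n).trans hn.le
  exact (ENNReal.mul_le_mul_iff_right (pow_ne_zero _ hr) (ENNReal.pow_ne_top hr')).1 h1

/-- Between two growth rates there is a rational radius. -/
lemma exists_rat_log_inv_between {c d : EReal} (h : c < d) :
    ∃ q : ℚ, ENNReal.ofReal q ≠ 0 ∧ c < ENNReal.log (ENNReal.ofReal q)⁻¹ ∧
      ENNReal.log (ENNReal.ofReal q)⁻¹ < d := by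
  obtain ⟨c, rfl⟩ := ENNReal.log_surjective c
  obtain ⟨d, rfl⟩ := ENNReal.log_surjective d
  rw [ENNReal.log_lt_log_iff] at h
  obtain ⟨q, -, h1, h2⟩ := ENNReal.lt_iff_exists_rat_btwn.1 (ENNReal.inv_lt_inv.2 h)
  refine ⟨q, (pos_of_gt h1).ne', ?_, ?_⟩
  · rw [ENNReal.log_lt_log_iff]
    exact ENNReal.lt_inv_iff_lt_inv.1 h2
  · rw [ENNReal.log_lt_log_iff]
    exact ENNReal.inv_lt_iff_inv_lt.1 h1

/-! ### Irreducible minorized kernels -/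

lemma le_convergenceParameter {φ : Measure S} {K : Kernel S S} {r : ℝ≥0∞} {x : S} {A : Set S} (hA : MeasurableSet A)
    (hφA : φ A ≠ 0) (h : potential K r x A < ⊤) : r ≤ convergenceParameter φ K :=
  le_sSup ⟨x, A, hA, pos_iff_ne_zero.2 hφA, h⟩

/-- The kernel `K` is `φ`-irreducible and satisfies the minorization `δ 1_C ⊗ μ ≤ K` with a
`φ`-positive and `μ`-positive set `C`. No finiteness is asked of `K`. -/
structure Minorized (φ : Measure S) (K : Kernel S S) (δ : ℝ≥0) (C : Set S) (μ : Measure S) :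
    Prop where
  irreducible : ∀ A, MeasurableSet A → φ A ≠ 0 → ∀ x, ∃ n, (K ^ n) x A ≠ 0
  measurableSet : MeasurableSet C
  measure_ne_zero : φ C ≠ 0
  const_ne_zero : δ ≠ 0
  small_ne_zero : μ C ≠ 0
  smul_le : ∀ x ∈ C, δ • μ ≤ K x

namespace Minorized

variable {φ : Measure S} {K : Kernel S S} {δ : ℝ≥0} {C : Set S} {μ : Measure S}

lemma base_ne_zero (H : Minorized φ K δ C μ) : φ ≠ 0 := fun h =>
  H.measure_ne_zero (by simp [h])

lemma small_measure_ne_zero (H : Minorized φ K δ C μ) : μ ≠ 0 := fun h =>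
  H.small_ne_zero (by simp [h])

lemma coe_ne_zero (H : Minorized φ K δ C μ) : (δ : ℝ≥0∞) ≠ 0 := by
  simpa using H.const_ne_zero

lemma exists_lintegral_pow_ne_zero (H : Minorized φ K δ C μ) {m : Measure S} (hm : m ≠ 0)
    {A : Set S} (hA : MeasurableSet A) (hφA : φ A ≠ 0) : ∃ n, ∫⁻ x, (K ^ n) x A ∂m ≠ 0 := by
  by_contra! hcon
  have hall : ∀ᵐ x ∂m, ∀ n, (K ^ n) x A = 0 := ae_all_iff.2 fun n =>
    (lintegral_eq_zero_iff (Kernel.measurable_coe _ hA)).1 (hcon n)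
  have : (ae m).NeBot := ae_neBot.2 hm
  obtain ⟨x, hx⟩ := hall.exists
  obtain ⟨n, hn⟩ := H.irreducible A hA hφA x
  exact hn (hx n)

lemma mul_lintegral_le (H : Minorized φ K δ C μ) (u : S → ℝ≥0∞) {x : S} (hx : x ∈ C) :
    (δ : ℝ≥0∞) * ∫⁻ y, u y ∂μ ≤ ∫⁻ y, u y ∂K x := by
  calc (δ : ℝ≥0∞) * ∫⁻ y, u y ∂μ = ∫⁻ y, u y ∂(δ • μ) := by
        rw [lintegral_smul_measure]; rfl
    _ ≤ ∫⁻ y, u y ∂K x := lintegral_mono' (H.smul_le x hx) le_rfl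

/-- Visit `C` at time `j`, regenerate, and go on for `k` steps. -/
lemma mul_lintegral_pow_le (H : Minorized φ K δ C μ) {u : S → ℝ≥0∞} (hu : Measurable u)
    (j k : ℕ) (x : S) :
    (K ^ j) x C * (δ * ∫⁻ y, ∫⁻ z, u z ∂(K ^ k) y ∂μ) ≤ ∫⁻ y, u y ∂(K ^ (j + (k + 1))) x := by
  rw [lintegral_pow_add K j (k + 1) hu, mul_comm, ← lintegral_indicator_const H.measurableSet]
  refine lintegral_mono fun y => ?_
  by_cases hy : y ∈ C
  · rw [Set.indicator_of_mem hy, lintegral_pow_succ K k hu]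
    exact H.mul_lintegral_le _ hy
  · rw [Set.indicator_of_notMem hy]
    exact zero_le

/-- Regenerating at each of the first `N` steps costs at most a factor `δ μ(C)` per step. -/
lemma pow_mul_lintegral_pow_le (H : Minorized φ K δ C μ) {u : S → ℝ≥0∞} (hu : Measurable u)
    (N k : ℕ) :
    (δ * μ C) ^ N * ∫⁻ y, ∫⁻ z, u z ∂(K ^ k) y ∂μ ≤ ∫⁻ y, ∫⁻ z, u z ∂(K ^ (N + k)) y ∂μ := by
  induction N with
  | zero => simp
  | succ N ih =>
    rw [pow_succ', mul_assoc, show N + 1 + k = 0 + (N + k + 1) by ring]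
    calc (δ * μ C) * ((δ * μ C) ^ N * ∫⁻ y, ∫⁻ z, u z ∂(K ^ k) y ∂μ)
        ≤ (δ * μ C) * ∫⁻ y, ∫⁻ z, u z ∂(K ^ (N + k)) y ∂μ := by gcongr
      _ = ∫⁻ y, (K ^ 0) y C * (δ * ∫⁻ y, ∫⁻ z, u z ∂(K ^ (N + k)) y ∂μ) ∂μ := by
          rw [lintegral_mul_const _ (Kernel.measurable_coe _ H.measurableSet)]
          have h0 : ∫⁻ y, (K ^ 0) y C ∂μ = μ C := by
            rw [← lintegral_indicator_one H.measurableSet]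
            refine lintegral_congr fun y => ?_
            rw [← lintegral_indicator_one H.measurableSet,
              lintegral_pow_zero K (measurable_one.indicator H.measurableSet)]
          rw [h0]
          ring
      _ ≤ _ := lintegral_mono fun y => H.mul_lintegral_pow_le hu 0 (N + k) y

/-- Whatever the initial measure, a growth rate below `log r⁻¹` forces the Green function to be
integrable with respect to the regeneration measure. -/
lemma lintegral_green_lt_top_of_growthRate_lt (H : Minorized φ K δ C μ) {m : Measure S}
    (hm : m ≠ 0) {u : S → ℝ≥0∞} (hu : Measurable u) {r : ℝ≥0∞} (hr : r ≠ 0)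
    (h : growthRate (fun n => ∫⁻ x, ∫⁻ y, u y ∂(K ^ n) x ∂m) < ENNReal.log r⁻¹) :
    ∫⁻ x, green K r u x ∂μ < ⊤ := by
  obtain ⟨N, hN⟩ := exists_tail_lt_top h
  obtain ⟨j, hj⟩ := H.exists_lintegral_pow_ne_zero hm H.measurableSet H.measure_ne_zero
  set κ : ℝ≥0∞ := (∫⁻ x, (K ^ j) x C ∂m) * δ * (δ * μ C) ^ N * r ^ (N + j + 1) with hκ
  have hκ0 : κ ≠ 0 := by
    have := H.coe_ne_zero
    have := H.small_ne_zero
    simp [κ, *]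
  refine ENNReal.lt_top_of_mul_ne_top_right (ne_of_lt (lt_of_le_of_lt ?_ hN)) hκ0
  rw [lintegral_green K r hu, ← ENNReal.tsum_mul_left]
  refine le_trans (ENNReal.tsum_le_tsum fun k => ?_)
    (ENNReal.tsum_comp_le_tsum_of_injective (add_left_injective (j + 1)) _)
  calc κ * (r ^ k * ∫⁻ x, ∫⁻ y, u y ∂(K ^ k) x ∂μ)
      = r ^ (N + (k + (j + 1))) * ((∫⁻ x, (K ^ j) x C ∂m) *
          (δ * ((δ * μ C) ^ N * ∫⁻ x, ∫⁻ y, u y ∂(K ^ k) x ∂μ))) := by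
        rw [hκ]; ring
    _ ≤ r ^ (N + (k + (j + 1))) * ((∫⁻ x, (K ^ j) x C ∂m) *
          (δ * ∫⁻ x, ∫⁻ y, u y ∂(K ^ (N + k)) x ∂μ)) := by
        gcongr
        exact H.pow_mul_lintegral_pow_le hu N k
    _ ≤ r ^ (N + (k + (j + 1))) * ∫⁻ x, ∫⁻ y, u y ∂(K ^ (N + (k + (j + 1)))) x ∂m := by
        rw [← lintegral_mul_const _ (Kernel.measurable_coe _ H.measurableSet),
          show N + (k + (j + 1)) = j + (N + k + 1) by ring]
        gcongr with x
        exact H.mul_lintegral_pow_le hu j (N + k) x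

/-- A superharmonic function that is integrable for the regeneration measure is finite
`φ`-almost everywhere, since its infinity set cannot be reached. -/
lemma ae_lt_top_of_superharmonic (H : Minorized φ K δ C μ) {v : S → ℝ≥0∞} (hv : Measurable v)
    {r : ℝ≥0∞} (hr : r ≠ 0) (h : ∀ x, r * ∫⁻ y, v y ∂K x ≤ v x) (hfin : ∫⁻ x, v x ∂μ < ⊤) :
    ∀ᵐ x ∂φ, v x < ⊤ := by
  have hA : MeasurableSet {x | v x = ⊤} := hv (measurableSet_singleton ⊤)
  by_contra hcon
  have hφA : φ {x | v x = ⊤} ≠ 0 := by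
    simpa [ae_iff] using hcon
  obtain ⟨n, hn⟩ := H.exists_lintegral_pow_ne_zero H.small_measure_ne_zero hA hφA
  refine hfin.ne (top_le_iff.1 ?_)
  calc (⊤ : ℝ≥0∞) = r ^ n * (⊤ * ∫⁻ x, (K ^ n) x {x | v x = ⊤} ∂μ) := by
        rw [ENNReal.top_mul hn, ENNReal.mul_top (pow_ne_zero _ hr)]
    _ = r ^ n * ∫⁻ x, ⊤ * (K ^ n) x {x | v x = ⊤} ∂μ := by
        rw [lintegral_const_mul _ (Kernel.measurable_coe _ hA)]
    _ ≤ r ^ n * ∫⁻ x, ∫⁻ y, v y ∂(K ^ n) x ∂μ := by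
        gcongr with x
        rw [← lintegral_indicator_const hA]
        refine lintegral_mono fun y => ?_
        by_cases hy : v y = ⊤
        · simp [hy]
        · simp [hy]
    _ = ∫⁻ x, r ^ n * ∫⁻ y, v y ∂(K ^ n) x ∂μ :=
        (lintegral_const_mul _ hv.lintegral_kernel).symm
    _ ≤ ∫⁻ x, v x ∂μ :=
        lintegral_mono fun x => pow_mul_lintegral_le_of_superharmonic K r hv h n x

lemma ae_green_lt_top (H : Minorized φ K δ C μ) {u : S → ℝ≥0∞} (hu : Measurable u)
    {r : ℝ≥0∞} (hr : r ≠ 0) (hfin : ∫⁻ x, green K r u x ∂μ < ⊤) :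
    ∀ᵐ x ∂φ, green K r u x < ⊤ :=
  H.ae_lt_top_of_superharmonic (measurable_green K r hu) hr (green_superharmonic K r hu) hfin

/-- For each rational radius at which it is integrable for the regeneration measure, the Green
function of the constant `1` is finite at `φ`-almost every state. -/
lemma ae_forall_rat_green_lt_top (H : Minorized φ K δ C μ) :
    ∀ᵐ x ∂φ, ∀ q : ℚ, ENNReal.ofReal q ≠ 0 →
      ∫⁻ y, green K (ENNReal.ofReal q) 1 y ∂μ < ⊤ → green K (ENNReal.ofReal q) 1 x < ⊤ := by
  rw [ae_all_iff]
  intro q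
  by_cases hq : ENNReal.ofReal q ≠ 0 ∧ ∫⁻ y, green K (ENNReal.ofReal q) 1 y ∂μ < ⊤
  · filter_upwards [H.ae_green_lt_top measurable_one hq.1 hq.2] with x hx _ _ using hx
  · exact Eventually.of_forall fun x h1 h2 => absurd ⟨h1, h2⟩ hq

/-! ### The convergence parameter -/

/-- If the potential of some `φ`-positive set is finite at some state, then the potential of `C`
is integrable for the regeneration measure. -/
lemma lintegral_green_lt_top_of_potential_lt_top (H : Minorized φ K δ C μ) {r : ℝ≥0∞}
    (hr : r ≠ 0) {x : S} {A : Set S} (hA : MeasurableSet A) (hφA : φ A ≠ 0)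
    (h : potential K r x A < ⊤) : ∫⁻ y, green K r (C.indicator 1) y ∂μ < ⊤ := by
  have hC1 : Measurable (C.indicator (1 : S → ℝ≥0∞)) := measurable_one.indicator H.measurableSet
  have hA1 : Measurable (A.indicator (1 : S → ℝ≥0∞)) := measurable_one.indicator hA
  rw [potential_eq_green K r x hA] at h
  set v := green K r (A.indicator 1) with hv
  have hvm : Measurable v := measurable_green K r hA1
  -- Starting from `x`, the chain regenerates with positive probability.
  have hμv : ∫⁻ y, v y ∂μ < ⊤ := by
    obtain ⟨m, hm⟩ := H.irreducible C H.measurableSet H.measure_ne_zero x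
    have hle : r ^ (m + 1) * ((K ^ m) x C * (δ * ∫⁻ y, v y ∂μ)) ≤ v x := by
      refine le_trans ?_ (pow_mul_lintegral_le_of_superharmonic K r hvm
        (green_superharmonic K r hA1) (m + 1) x)
      gcongr
      have := H.mul_lintegral_pow_le hvm m 0 x
      simpa only [lintegral_pow_zero K hvm, zero_add] using this
    refine ENNReal.lt_top_of_mul_ne_top_right (a := r ^ (m + 1) * ((K ^ m) x C * δ)) ?_ ?_
    · refine ne_of_lt (lt_of_le_of_lt ?_ h)
      rw [mul_assoc, mul_assoc]
      exact hle
    · have := H.coe_ne_zero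
      simp [*]
  -- From `C` the chain regenerates, and reaches `A` afterwards with positive probability.
  obtain ⟨j, hj⟩ := H.exists_lintegral_pow_ne_zero H.small_measure_ne_zero hA hφA
  have hκ0 : r ^ (j + 1) * (δ * ∫⁻ y, (K ^ j) y A ∂μ) ≠ 0 := by
    have := H.coe_ne_zero
    simp [*]
  refine ENNReal.lt_top_of_mul_ne_top_right (ne_of_lt (lt_of_le_of_lt ?_ hμv)) hκ0
  rw [← lintegral_const_mul _ (measurable_green K r hC1)]
  refine lintegral_mono fun y => ?_
  rw [hv, green, green, ← ENNReal.tsum_mul_left]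
  refine le_trans (ENNReal.tsum_le_tsum fun k => ?_)
    (ENNReal.tsum_comp_le_tsum_of_injective (add_left_injective (j + 1)) _)
  have := H.mul_lintegral_pow_le hA1 k j y
  simp only [lintegral_indicator_one hA] at this
  simp only [lintegral_indicator_one hA, lintegral_indicator_one H.measurableSet]
  calc r ^ (j + 1) * (δ * ∫⁻ y, (K ^ j) y A ∂μ) * (r ^ k * (K ^ k) y C)
      = r ^ (k + (j + 1)) * ((K ^ k) y C * (δ * ∫⁻ y, (K ^ j) y A ∂μ)) := by ring
    _ ≤ _ := by gcongr

lemma le_convergenceParameter_of_green_one (H : Minorized φ K δ C μ) {r : ℝ≥0∞} {x : S}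
    (h : green K r 1 x < ⊤) : r ≤ convergenceParameter φ K := by
  refine le_convergenceParameter (x := x) MeasurableSet.univ
    (Measure.measure_univ_ne_zero.2 H.base_ne_zero) ?_
  rwa [potential_eq_green K r x MeasurableSet.univ, Set.indicator_univ]

lemma lintegral_green_lt_top_of_lt_convergenceParameter (H : Minorized φ K δ C μ) {r : ℝ≥0∞}
    (hr : r < convergenceParameter φ K) : ∫⁻ y, green K r (C.indicator 1) y ∂μ < ⊤ := by
  obtain ⟨r', ⟨x, A, hA, hφA, h⟩, hlt⟩ := lt_sSup_iff.1 hr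
  refine lt_of_le_of_lt ?_ (H.lintegral_green_lt_top_of_potential_lt_top (pos_of_gt hlt).ne' hA
    hφA.ne' h)
  refine lintegral_mono fun y => ENNReal.tsum_le_tsum fun n => ?_
  gcongr

/-- The reciprocal `1 / R` is at least the weight `δ μ(C)` of a one-step return to `C`. -/
lemma convergenceParameter_le (H : Minorized φ K δ C μ) :
    convergenceParameter φ K ≤ (δ * μ C)⁻¹ := by
  refine sSup_le fun r ⟨x, A, hA, hφA, h⟩ => ?_
  rcases eq_or_ne r 0 with rfl | hr
  · exact zero_le
  have hfin := H.lintegral_green_lt_top_of_potential_lt_top hr hA hφA.ne' h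
  have hC1 : Measurable (C.indicator (1 : S → ℝ≥0∞)) := measurable_one.indicator H.measurableSet
  set β := ∫⁻ y, green K r (C.indicator 1) y ∂μ with hβ
  have hle : (1 + r * (δ * β)) * μ C ≤ β := by
    rw [hβ, ← lintegral_indicator_const H.measurableSet]
    refine lintegral_mono fun y => ?_
    by_cases hy : y ∈ C
    · rw [Set.indicator_of_mem hy, green_eq K r hC1, Set.indicator_of_mem hy, Pi.one_apply]
      gcongr
      exact H.mul_lintegral_le _ hy
    · rw [Set.indicator_of_notMem hy]
      exact zero_le
  have hβ0 : β ≠ 0 := by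
    rintro h0
    rw [h0, nonpos_iff_eq_zero] at hle
    exact H.small_ne_zero (by simpa using hle)
  rw [ENNReal.le_inv_iff_mul_le]
  have : β * (r * (δ * μ C)) ≤ β * 1 := by
    rw [mul_one]
    refine le_trans ?_ hle
    rw [add_mul]
    refine le_trans (le_of_eq ?_) le_add_self
    ring
  exact (ENNReal.mul_le_mul_iff_right hβ0 hfin.ne).1 this

lemma convergenceParameter_ne_top (H : Minorized φ K δ C μ) : convergenceParameter φ K ≠ ⊤ := by
  refine ne_top_of_le_ne_top ?_ H.convergenceParameter_le
  rw [ENNReal.inv_ne_top]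
  exact mul_ne_zero H.coe_ne_zero H.small_ne_zero

/-- The logarithm of `1 / R` is a lower bound of the growth rate, whatever the initial state. -/
lemma log_inv_convergenceParameter_le_growthRate (H : Minorized φ K δ C μ) (x : S) :
    ENNReal.log (convergenceParameter φ K)⁻¹ ≤ growthRate (fun n => (K ^ n) x Set.univ) := by
  refine le_of_forall_gt_imp_ge_of_dense fun c hc => ?_
  obtain ⟨q, hq0, hq1, hq2⟩ := exists_rat_log_inv_between hc
  refine le_trans (ENNReal.log_le_log (ENNReal.inv_le_inv.2 ?_)) hq2.le
  have hfin := H.lintegral_green_lt_top_of_growthRate_lt (m := Measure.dirac x) (u := 1)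
    (Measure.dirac_ne_zero) measurable_one hq0 (by
      refine lt_of_eq_of_lt ?_ hq1
      congr 1
      ext n
      rw [lintegral_dirac' _ measurable_one.lintegral_kernel]
      simp)
  have : (ae φ).NeBot := ae_neBot.2 H.base_ne_zero
  obtain ⟨y, hy⟩ := (H.ae_green_lt_top measurable_one hq0 hfin).exists
  exact H.le_convergenceParameter_of_green_one hy

end Minorized

lemma expWeight_ne_zero {T : Type*} (g : T → ℝ) (y : T) : ENNReal.ofReal (Real.exp (g y)) ≠ 0 :=
  (ENNReal.ofReal_pos.2 (Real.exp_pos _)).ne'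

/-! ### Exponential moments of the chain as powers of the transform kernel -/

lemma measurable_expWeight {g : S → ℝ} (hg : Measurable g) :
    Measurable fun y => ENNReal.ofReal (Real.exp (g y)) :=
  hg.exp.ennreal_ofReal

lemma hatKernel_apply {g : S → ℝ} (hg : Measurable g) (K : Kernel S S) [IsSFiniteKernel K]
    (x : S) : hatKernel g K x = hatMeasure g (K x) :=
  Kernel.withDensity_apply K (f := fun _ y => ENNReal.ofReal (Real.exp (g y)))
    ((measurable_expWeight hg).comp measurable_snd) x

lemma lintegral_hatMeasure {g : S → ℝ} (hg : Measurable g) (m : Measure S) {u : S → ℝ≥0∞}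
    (hu : Measurable u) :
    ∫⁻ y, u y ∂hatMeasure g m = ∫⁻ y, ENNReal.ofReal (Real.exp (g y)) * u y ∂m :=
  lintegral_withDensity_eq_lintegral_mul _ (measurable_expWeight hg) hu

lemma map_eval_zero_chainLaw (P : Kernel S S) [IsMarkovKernel P] (m : Measure S)
    [IsProbabilityMeasure m] : (chainLaw P m).map (fun X => X 0) = m := by
  have h : (chainLaw P m).map (Preorder.frestrictLe 0)
      = m.map (MeasurableEquiv.piUnique (fun _ : Finset.Iic 0 => S)).symm := by
    rw [chainLaw, Kernel.trajMeasure, Measure.map_comp _ _ (by fun_prop),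
      Kernel.traj_map_frestrictLe, Kernel.partialTraj_self, Measure.id_comp]
  have h2 := congrArg (fun ρ => ρ.map (fun w : Finset.Iic 0 → S => w ⟨0, by simp⟩)) h
  beta_reduce at h2
  rw [Measure.map_map (by fun_prop) (by fun_prop), Measure.map_map (by fun_prop) (by fun_prop)]
    at h2
  refine Eq.trans ?_ (h2.trans ?_)
  · rfl
  · exact Measure.map_id

/-- The Markov property: a functional `Φ` of the path up to time `n` sees the next state through
the kernel only. -/
lemma lintegral_chainLaw_succ (P : Kernel S S) [IsMarkovKernel P] (m : Measure S)
    [IsProbabilityMeasure m] (n : ℕ) {Φ : (ℕ → S) → ℝ≥0∞} (hΦ : Measurable Φ)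
    (hΦn : ∀ X, Φ (fun i => X (min i n)) = Φ X) {ψ : S → ℝ≥0∞} (hψ : Measurable ψ) :
    ∫⁻ X, Φ X * ψ (X (n + 1)) ∂chainLaw P m = ∫⁻ X, Φ X * ∫⁻ y, ψ y ∂P (X n) ∂chainLaw P m := by
  set ext : (Finset.Iic n → S) → ℕ → S := fun w i => w ⟨min i n, by simp⟩ with hext
  have hextm : Measurable ext := measurable_pi_lambda _ fun i => measurable_pi_apply _
  have hfr : ∀ X : ℕ → S, Φ (ext (Preorder.frestrictLe (π := fun _ => S) n X)) = Φ X := hΦn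
  have key := Kernel.map_frestrictLe_trajMeasure_compProd_eq_map_trajMeasure
    (X := fun _ => S) (μ₀ := m) (κ := fun n => P.comap (fun w : (Finset.Iic n → S) =>
      w ⟨n, Finset.mem_Iic.2 le_rfl⟩) (measurable_pi_apply _)) (a := n)
  have hF : Measurable fun p : (Finset.Iic n → S) × S => Φ (ext p.1) * ψ p.2 :=
    (hΦ.comp (hextm.comp measurable_fst)).mul (hψ.comp measurable_snd)
  have h2 := congrArg (fun ρ => ∫⁻ p, Φ (ext p.1) * ψ p.2 ∂ρ) key
  beta_reduce at h2
  rw [Measure.lintegral_compProd hF, lintegral_map hF.lintegral_kernel_prod_right'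
    (by fun_prop), lintegral_map hF (by fun_prop)] at h2
  simp only [hfr] at h2
  refine h2.symm.trans (lintegral_congr fun X => ?_)
  rw [lintegral_const_mul _ hψ]
  rfl

lemma lintegral_chainLaw_mul_exp_mul (P : Kernel S S) [IsMarkovKernel P] (m : Measure S)
    [IsProbabilityMeasure m] {g : S → ℝ} (hg : Measurable g) {u v : S → ℝ≥0∞}
    (hu : Measurable u) (hv : Measurable v) (n : ℕ) :
    ∫⁻ X, v (X 0) * ENNReal.ofReal (Real.exp (∑ i ∈ Finset.Icc 1 n, g (X i))) * u (X n)
        ∂chainLaw P m = ∫⁻ x, v x * ∫⁻ y, u y ∂(hatKernel g P ^ n) x ∂m := by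
  induction n generalizing u with
  | zero =>
    simp only [lintegral_pow_zero _ hu]
    conv_rhs => rw [← map_eval_zero_chainLaw P m]
    rw [lintegral_map (f := fun x => v x * u x) (hv.mul hu) (measurable_pi_apply 0)]
    simp
  | succ n ih =>
    have hΦ : Measurable fun X : ℕ → S =>
        v (X 0) * ENNReal.ofReal (Real.exp (∑ i ∈ Finset.Icc 1 n, g (X i))) := by
      refine (hv.comp (measurable_pi_apply 0)).mul (Measurable.ennreal_ofReal
        (Real.measurable_exp.comp (Finset.measurable_sum _ fun i _ =>
          hg.comp (measurable_pi_apply i))))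
    have hΦn : ∀ X : ℕ → S, v (X (min 0 n)) *
        ENNReal.ofReal (Real.exp (∑ i ∈ Finset.Icc 1 n, g (X (min i n)))) =
        v (X 0) * ENNReal.ofReal (Real.exp (∑ i ∈ Finset.Icc 1 n, g (X i))) := by
      intro X
      rw [Nat.zero_min]
      congr 3
      refine Finset.sum_congr rfl fun i hi => ?_
      rw [min_eq_left (Finset.mem_Icc.1 hi).2]
    calc _ = ∫⁻ X, v (X 0) * ENNReal.ofReal (Real.exp (∑ i ∈ Finset.Icc 1 n, g (X i))) *
          (ENNReal.ofReal (Real.exp (g (X (n + 1)))) * u (X (n + 1))) ∂chainLaw P m := by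
          refine lintegral_congr fun X => ?_
          rw [Finset.sum_Icc_succ_top (by lia), Real.exp_add,
            ENNReal.ofReal_mul (Real.exp_pos _).le]
          ring
      _ = ∫⁻ X, v (X 0) * ENNReal.ofReal (Real.exp (∑ i ∈ Finset.Icc 1 n, g (X i))) *
          ∫⁻ y, u y ∂hatKernel g P (X n) ∂chainLaw P m := by
          rw [lintegral_chainLaw_succ P m n hΦ hΦn
            (ψ := fun y => ENNReal.ofReal (Real.exp (g y)) * u y)
            ((measurable_expWeight hg).mul hu)]
          refine lintegral_congr fun X => ?_
          rw [hatKernel_apply hg, lintegral_hatMeasure hg _ hu]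
      _ = _ := by
          rw [ih hu.lintegral_kernel]
          refine lintegral_congr fun x => ?_
          rw [lintegral_pow_add _ n 1 hu, pow_one]

lemma expMoment_eq (P : Kernel S S) [IsMarkovKernel P] (m : Measure S)
    [IsProbabilityMeasure m] {g : S → ℝ} (hg : Measurable g) (n : ℕ) :
    expMoment P g m n = ∫⁻ x, (hatKernel g P ^ n) x Set.univ ∂m := by
  have h := lintegral_chainLaw_mul_exp_mul P m hg measurable_one measurable_one n
  simpa [expMoment] using h

lemma expMomentRegenOne_succ (P : Kernel S S) [IsMarkovKernel P] (m : Measure S)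
    [IsProbabilityMeasure m] {g : S → ℝ} (hg : Measurable g) (n : ℕ) :
    expMomentRegenOne P g m (n + 1)
      = ∫⁻ x, (hatKernel g P ^ n) x Set.univ ∂hatMeasure g m := by
  have h := lintegral_chainLaw_mul_exp_mul P m hg measurable_one (measurable_expWeight hg) n
  rw [lintegral_hatMeasure hg _ (Kernel.measurable_coe _ MeasurableSet.univ)]
  simp only [Pi.one_apply, mul_one, lintegral_one] at h
  rw [← h, expMomentRegenOne]
  refine lintegral_congr fun X => ?_
  rw [← ENNReal.ofReal_mul (Real.exp_pos _).le, ← Real.exp_add, Finset.sum_range_succ',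
    add_comm, Finset.range_eq_Ico, Finset.sum_Ico_add' (fun i => g (X i)) 0 n 1]
  rfl

/-! ### Perturbed kernels -/

section

variable (P : Kernel S S) [IsMarkovKernel P] (ν : Measure S) [IsProbabilityMeasure ν]

lemma hatPerturbed_apply (ε : ℝ≥0) {g : S → ℝ} (hg : Measurable g) (x : S) :
    hatPerturbed P ν ε g x = hatKernel g P x + ε • hatMeasure g ν := by
  rw [hatPerturbed, hatKernel_apply hg, hatKernel_apply hg, perturbed, add_apply,
    Kernel.const_apply, hatMeasure, hatMeasure, hatMeasure, withDensity_add_measure]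
  congr 1
  exact withDensity_smul_measure (ε : ℝ≥0∞) _

lemma hatPerturbed_zero {g : S → ℝ} (hg : Measurable g) :
    hatPerturbed P ν 0 g = hatKernel g P := by
  ext1 x
  rw [hatPerturbed_apply P ν 0 hg, zero_smul, add_zero]

lemma lintegral_hatPerturbed (ε : ℝ≥0) {g : S → ℝ} (hg : Measurable g) (u : S → ℝ≥0∞) (x : S) :
    ∫⁻ y, u y ∂hatPerturbed P ν ε g x
      = ∫⁻ y, u y ∂hatKernel g P x + ε * ∫⁻ y, u y ∂hatMeasure g ν := by
  rw [hatPerturbed_apply P ν ε hg, lintegral_add_measure, lintegral_smul_measure]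
  rfl

/-- If `r ε ν̂(G) ≤ 1/2` for the Green function `G` of `P̂`, then `2 G` is a supersolution for
`P̂^{(ε)}`. -/
lemma green_hatPerturbed_le (ε : ℝ≥0) {g : S → ℝ} (hg : Measurable g) {r : ℝ≥0∞}
    (h : r * (ε * ∫⁻ y, green (hatKernel g P) r 1 y ∂hatMeasure g ν) ≤ 1 / 2) (x : S) :
    green (hatPerturbed P ν ε g) r 1 x ≤ 2 * green (hatKernel g P) r 1 x := by
  have hG := measurable_green (hatKernel g P) r (u := 1) measurable_one
  refine green_le_of_supersolution _ r (w := fun x => 2 * green (hatKernel g P) r 1 x)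
    measurable_one (fun x => ?_) x
  rw [lintegral_const_mul _ hG, lintegral_hatPerturbed P ν ε hg,
    green_eq (hatKernel g P) r measurable_one x]
  simp only [Pi.one_apply]
  calc 1 + r * (2 * (∫⁻ y, green (hatKernel g P) r 1 y ∂hatKernel g P x
          + ε * ∫⁻ y, green (hatKernel g P) r 1 y ∂hatMeasure g ν))
      = (1 + 2 * (r * (ε * ∫⁻ y, green (hatKernel g P) r 1 y ∂hatMeasure g ν)))
          + 2 * (r * ∫⁻ y, green (hatKernel g P) r 1 y ∂hatKernel g P x) := by ring
    _ ≤ (1 + 2 * (1 / 2)) + 2 * (r * ∫⁻ y, green (hatKernel g P) r 1 y ∂hatKernel g P x) := by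
        gcongr
    _ = 2 * (1 + r * ∫⁻ y, green (hatKernel g P) r 1 y ∂hatKernel g P x) := by
        rw [mul_add, mul_one, one_div, ENNReal.mul_inv_cancel (by simp) (by simp), one_add_one_eq_two]

lemma eventually_mul_coe_mul_le_half {r c : ℝ≥0∞} (hr : r ≠ ⊤) (hc : c ≠ ⊤) :
    ∀ᶠ ε : ℝ≥0 in 𝓝[>] 0, r * (ε * c) ≤ 1 / 2 := by
  have ht : Tendsto (fun ε : ℝ≥0 => r * (ε * c)) (𝓝 0) (𝓝 (r * ((0 : ℝ≥0) * c))) :=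
    ENNReal.Tendsto.const_mul (ENNReal.Tendsto.mul_const
      (ENNReal.tendsto_coe.2 tendsto_id) (Or.inr hc)) (Or.inr hr)
  rw [ENNReal.coe_zero, zero_mul, mul_zero] at ht
  exact (ht.eventually (ge_mem_nhds (by simp))).filter_mono nhdsWithin_le_nhds

variable {P ν}

lemma minorized_hatPerturbed {φ : Measure S} (hirr : Kernel.IsIrreducible φ P) {δ : ℝ≥0}
    (hδ : 0 < δ) {C : Set S} (hCm : MeasurableSet C) (hC : 0 < φ C) (hνC : 0 < ν C)
    (hM : ∀ x ∈ C, ∀ E : Set S, MeasurableSet E → (δ : ℝ≥0∞) * ν E ≤ P x E) {g : S → ℝ}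
    (hg : Measurable g) (ε : ℝ≥0) :
    Minorized φ (hatPerturbed P ν ε g) δ C (hatMeasure g ν) where
  irreducible A hA hφA x := by
    obtain ⟨n, hn⟩ := hirr.irreducible hA (pos_iff_ne_zero.2 hφA) x
    refine ⟨n, fun h0 => hn.ne' (pow_absolutelyContinuous (fun y => ?_) n x h0)⟩
    rw [hatPerturbed_apply P ν ε hg]
    refine Measure.AbsolutelyContinuous.add_right ?_ _
    rw [hatKernel_apply hg]
    exact withDensity_absolutelyContinuous' (measurable_expWeight hg).aemeasurable
      (Eventually.of_forall (expWeight_ne_zero g))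
  measurableSet := hCm
  measure_ne_zero := hC.ne'
  const_ne_zero := hδ.ne'
  small_ne_zero h0 := hνC.ne' <| withDensity_absolutelyContinuous'
    (measurable_expWeight hg).aemeasurable (Eventually.of_forall (expWeight_ne_zero g)) h0
  smul_le x hx := by
    rw [hatPerturbed_apply P ν ε hg, hatKernel_apply hg]
    refine le_trans ?_ (Measure.le_add_right le_rfl)
    have h1 : δ • hatMeasure g ν = hatMeasure g (δ • ν) :=
      (withDensity_smul_measure (δ : ℝ≥0∞) _).symm
    rw [h1]
    have h2 : δ • ν ≤ P x := Measure.le_iff.2 fun E hE => hM x hx E hE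
    refine Measure.le_iff.2 fun E hE => ?_
    rw [hatMeasure, hatMeasure, withDensity_apply _ hE, withDensity_apply _ hE]
    exact lintegral_mono' (Measure.restrict_mono le_rfl h2) le_rfl

end

/-! ### Growth rates of exponential moments -/

/-- A version of `Minorized.lintegral_green_lt_top_of_growthRate_lt` for total masses. -/
lemma Minorized.lintegral_green_one_lt_top {φ : Measure S} {K : Kernel S S} {δ : ℝ≥0}
    {C : Set S} {μ : Measure S} (H : Minorized φ K δ C μ) {m : Measure S} (hm : m ≠ 0)
    {r : ℝ≥0∞} (hr : r ≠ 0)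
    (h : growthRate (fun n => ∫⁻ x, (K ^ n) x Set.univ ∂m) < ENNReal.log r⁻¹) :
    ∫⁻ x, green K r 1 x ∂μ < ⊤ :=
  H.lintegral_green_lt_top_of_growthRate_lt hm measurable_one hr (by simpa using h)

lemma growthRate_mass_le {K : Kernel S S} {m : Measure S} {r : ℝ≥0∞} (hr : r ≠ 0) (hr' : r ≠ ⊤)
    (h : ∫⁻ x, green K r 1 x ∂m < ⊤) :
    growthRate (fun n => ∫⁻ x, (K ^ n) x Set.univ ∂m) ≤ ENNReal.log r⁻¹ := by
  refine growthRate_le_of_tsum_lt_top hr hr' ?_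
  simpa [lintegral_green K r measurable_one] using h

lemma growthRate_mass_le_of_green_lt_top {K : Kernel S S} {x : S} {r : ℝ≥0∞} (hr : r ≠ 0)
    (hr' : r ≠ ⊤) (h : green K r 1 x < ⊤) :
    growthRate (fun n => (K ^ n) x Set.univ) ≤ ENNReal.log r⁻¹ := by
  refine growthRate_le_of_tsum_lt_top hr hr' ?_
  simpa [green] using h

lemma lintegral_pow_univ_dirac (K : Kernel S S) (n : ℕ) (x : S) :
    ∫⁻ y, (K ^ n) y Set.univ ∂Measure.dirac x = (K ^ n) x Set.univ :=
  lintegral_dirac' _ (Kernel.measurable_coe _ MeasurableSet.univ)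

lemma gartnerEllis_eq (P : Kernel S S) [IsMarkovKernel P] (m : Measure S)
    [IsProbabilityMeasure m] {g : S → ℝ} (hg : Measurable g) :
    gartnerEllis P g m = growthRate fun n => ∫⁻ x, (hatKernel g P ^ n) x Set.univ ∂m := by
  simp only [gartnerEllis, growthRate, expMoment_eq P m hg]

lemma gartnerEllis_dirac_eq (P : Kernel S S) [IsMarkovKernel P] (x : S) {g : S → ℝ}
    (hg : Measurable g) :
    gartnerEllis P g (Measure.dirac x) = growthRate fun n => (hatKernel g P ^ n) x Set.univ := by
  simp only [gartnerEllis_eq P _ hg, lintegral_pow_univ_dirac]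

/-- Where `g` is bounded `ν`-almost everywhere, `ν` is dominated by a multiple of its transform. -/
lemma lintegral_lt_top_of_hatMeasure {ν : Measure S} {g : S → ℝ} (hg : Measurable g) {B : ℝ}
    (hB : ∀ᵐ x ∂ν, |g x| ≤ B) {u : S → ℝ≥0∞} (hu : Measurable u)
    (h : ∫⁻ x, u x ∂hatMeasure g ν < ⊤) : ∫⁻ x, u x ∂ν < ⊤ := by
  have hle : ∫⁻ x, u x ∂ν ≤ ENNReal.ofReal (Real.exp B) * ∫⁻ x, u x ∂hatMeasure g ν := by
    rw [lintegral_hatMeasure hg _ hu, ← lintegral_const_mul (f := fun y => _ * u y) _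
      ((measurable_expWeight hg).mul hu)]
    refine lintegral_mono_ae ?_
    filter_upwards [hB] with x hx
    rw [← mul_assoc, ← ENNReal.ofReal_mul (Real.exp_pos _).le, ← Real.exp_add]
    refine le_mul_of_one_le_left zero_le ?_
    rw [ENNReal.one_le_ofReal]
    exact Real.one_le_exp (by linarith [neg_abs_le (g x)])
  exact hle.trans_lt (ENNReal.mul_lt_top ENNReal.ofReal_lt_top h)

lemma hatMeasure_univ_lt_top {ν : Measure S} [IsProbabilityMeasure ν] {g : S → ℝ} {B : ℝ}
    (hB : ∀ᵐ x ∂ν, |g x| ≤ B) : hatMeasure g ν Set.univ < ⊤ := by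
  rw [hatMeasure, withDensity_apply _ MeasurableSet.univ, setLIntegral_univ]
  calc ∫⁻ x, ENNReal.ofReal (Real.exp (g x)) ∂ν ≤ ∫⁻ _, ENNReal.ofReal (Real.exp B) ∂ν := by
        refine lintegral_mono_ae ?_
        filter_upwards [hB] with x hx
        gcongr
        exact (le_abs_self _).trans hx
    _ < ⊤ := by simp

lemma exists_lintegral_green_lt_top {P : Kernel S S} [IsMarkovKernel P] {φ ν : Measure S} {δ : ℝ≥0}
    {C : Set S} {g : S → ℝ} (H : Minorized φ (hatKernel g P) δ C (hatMeasure g ν))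
    (hg : Measurable g) (hdom : InDomain P φ g) :
    ∃ r : ℝ≥0∞, r ≠ 0 ∧ r ≠ ⊤ ∧
      ∫⁻ y, green (hatKernel g P) r 1 y ∂hatMeasure g ν < ⊤ := by
  have : (ae φ).NeBot := ae_neBot.2 H.base_ne_zero
  obtain ⟨x, hx⟩ := hdom.exists
  obtain ⟨q, hq0, hq1, -⟩ := exists_rat_log_inv_between hx
  rw [gartnerEllis_eq P _ hg] at hq1
  exact ⟨_, hq0, ENNReal.ofReal_ne_top,
    H.lintegral_green_one_lt_top Measure.dirac_ne_zero hq0 hq1⟩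

section

variable {P : Kernel S S} [IsMarkovKernel P] {φ ν : Measure S} [IsProbabilityMeasure ν]
  {δ : ℝ≥0} {C : Set S} {g : S → ℝ}

/-- The growth rate is almost everywhere the one of the chain started from `ν`: both are minus the
logarithm of the critical radius below which `ν̂ (G_r 1)` is finite. -/
lemma ae_gartnerEllis_eq (H : Minorized φ (hatKernel g P) δ C (hatMeasure g ν))
    (hg : Measurable g) {B : ℝ} (hB : ∀ᵐ x ∂ν, |g x| ≤ B) :
    ∀ᵐ x ∂φ, gartnerEllis P g (Measure.dirac x) = gartnerEllis P g ν := by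
  filter_upwards [H.ae_forall_rat_green_lt_top] with x hx
  refine le_antisymm (le_of_forall_gt_imp_ge_of_dense fun c hc => ?_)
    (le_of_forall_gt_imp_ge_of_dense fun c hc => ?_)
  · obtain ⟨q, hq0, hq1, hq2⟩ := exists_rat_log_inv_between hc
    rw [gartnerEllis_eq P _ hg] at hq1
    rw [gartnerEllis_dirac_eq P x hg]
    have hfin := H.lintegral_green_one_lt_top (IsProbabilityMeasure.ne_zero ν) hq0 hq1
    exact (growthRate_mass_le_of_green_lt_top hq0 ENNReal.ofReal_ne_top (hx q hq0 hfin)).trans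
      hq2.le
  · obtain ⟨q, hq0, hq1, hq2⟩ := exists_rat_log_inv_between hc
    rw [gartnerEllis_eq P _ hg] at hq1 ⊢
    have hfin := H.lintegral_green_one_lt_top Measure.dirac_ne_zero hq0 hq1
    exact (growthRate_mass_le hq0 ENNReal.ofReal_ne_top (lintegral_lt_top_of_hatMeasure hg hB
      (measurable_green _ _ measurable_one) hfin)).trans hq2.le

lemma iSup_log_expMomentRegenOne_lt_top
    (H : Minorized φ (hatKernel g P) δ C (hatMeasure g ν)) (hg : Measurable g)
    (hdom : InDomain P φ g) {N : ℕ} (hN : 1 ≤ N) :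
    (⨆ n : ℕ, ⨆ _ : N ≤ n, ENNReal.log (expMomentRegenOne P g ν n) / (n : EReal)) < ⊤ := by
  obtain ⟨r, hr0, hr, hfin⟩ := exists_lintegral_green_lt_top H hg hdom
  rw [lintegral_green _ _ measurable_one] at hfin
  set M := ∑' n : ℕ, r ^ n * ∫⁻ x, ∫⁻ y, (1 : S → ℝ≥0∞) y ∂(hatKernel g P ^ n) x ∂hatMeasure g ν
  have hbound : max M 1 * max r⁻¹ 1 < ⊤ :=
    ENNReal.mul_lt_top (max_lt hfin ENNReal.one_lt_top)
      (max_lt (ENNReal.inv_lt_top.2 (pos_iff_ne_zero.2 hr0)) ENNReal.one_lt_top)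
  refine lt_of_le_of_lt (iSup₂_le fun n hn => ?_) (ENNReal.log_lt_top_iff.2 hbound)
  rw [log_div_le_log_iff (hN.trans hn)]
  obtain ⟨k, rfl⟩ : ∃ k, n = k + 1 := ⟨n - 1, by lia⟩
  rw [expMomentRegenOne_succ P ν hg]
  have hk : r ^ k * ∫⁻ x, (hatKernel g P ^ k) x Set.univ ∂hatMeasure g ν ≤ M := by
    have := ENNReal.le_tsum (f := fun n : ℕ =>
      r ^ n * ∫⁻ x, ∫⁻ y, (1 : S → ℝ≥0∞) y ∂(hatKernel g P ^ n) x ∂hatMeasure g ν) k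
    simpa [M] using this
  calc ∫⁻ x, (hatKernel g P ^ k) x Set.univ ∂hatMeasure g ν
      = r⁻¹ ^ k * (r ^ k * ∫⁻ x, (hatKernel g P ^ k) x Set.univ ∂hatMeasure g ν) := by
        rw [← mul_assoc, ← mul_pow, ENNReal.inv_mul_cancel hr0 hr, one_pow, one_mul]
    _ ≤ max r⁻¹ 1 ^ k * M := by gcongr; exact le_max_left _ _
    _ ≤ max r⁻¹ 1 ^ (k + 1) * max M 1 ^ (k + 1) := by
        gcongr
        · exact le_max_right _ _
        · lia
        · exact (le_max_left M 1).trans (le_self_pow₀ (le_max_right _ _) (by lia))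
    _ = (max M 1 * max r⁻¹ 1) ^ (k + 1) := by rw [mul_pow, mul_comm]

/-! ### Vanishing perturbations -/

lemma ae_tendsto_perturbedLimit (H : Minorized φ (hatKernel g P) δ C (hatMeasure g ν))
    (hg : Measurable g) :
    ∀ᵐ x ∂φ, Tendsto (fun ε : ℝ≥0 => perturbedLimit P ν ε g x) (𝓝[>] 0)
      (𝓝 (gartnerEllis P g (Measure.dirac x))) := by
  filter_upwards [H.ae_forall_rat_green_lt_top] with x hx
  rw [tendsto_order]
  refine ⟨fun c hc => Eventually.of_forall fun ε => hc.trans_le ?_, fun c hc => ?_⟩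
  · rw [gartnerEllis_dirac_eq P x hg]
    refine growthRate_mono fun n => ?_
    have := lintegral_pow_le_of_kernel_le (K := hatKernel g P) (L := hatPerturbed P ν ε g)
      (fun y => by rw [hatPerturbed_apply P ν ε hg]; exact Measure.le_add_right le_rfl)
      (u := 1) measurable_one n x
    simpa using this
  · obtain ⟨q, hq0, hq1, hq2⟩ := exists_rat_log_inv_between hc
    rw [gartnerEllis_eq P _ hg] at hq1
    have hfin := H.lintegral_green_one_lt_top Measure.dirac_ne_zero hq0 hq1
    filter_upwards [eventually_mul_coe_mul_le_half ENNReal.ofReal_ne_top hfin.ne] with ε hε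
    refine lt_of_le_of_lt (growthRate_mass_le_of_green_lt_top hq0 ENNReal.ofReal_ne_top ?_) hq2
    exact (green_hatPerturbed_le P ν ε hg hε x).trans_lt
      (ENNReal.mul_lt_top (by simp) (hx q hq0 hfin))

lemma convergenceParameter_hatPerturbed_ne_zero
    (H : Minorized φ (hatKernel g P) δ C (hatMeasure g ν))
    (hg : Measurable g) (hdom : InDomain P φ g) (ε : ℝ≥0)
    (Hε : Minorized φ (hatPerturbed P ν ε g) δ C (hatMeasure g ν)) :
    convergenceParameter φ (hatPerturbed P ν ε g) ≠ 0 := by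
  obtain ⟨r, hr0, hr, hfin⟩ := exists_lintegral_green_lt_top H hg hdom
  -- Shrinking the radius to `η r` brings `η r ε ν̂(G)` below `1/2`.
  obtain ⟨η, hη, hη0⟩ : ∃ η : ℝ≥0, r * (η * (ε *
      ∫⁻ y, green (hatKernel g P) r 1 y ∂hatMeasure g ν)) ≤ 1 / 2 ∧ η ∈ Set.Ioo 0 1 :=
    ((eventually_mul_coe_mul_le_half hr (ENNReal.mul_ne_top ENNReal.coe_ne_top hfin.ne)).and
      (Ioo_mem_nhdsGT one_pos)).exists
  have hle : (η : ℝ≥0∞) * r ≤ r := mul_le_of_le_one_left zero_le (by exact_mod_cast hη0.2.le)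
  have hmono : ∀ y, green (hatKernel g P) (η * r) 1 y ≤ green (hatKernel g P) r 1 y := fun y =>
    ENNReal.tsum_le_tsum fun n => by gcongr
  have hη0' : (η : ℝ≥0∞) * r ≠ 0 :=
    mul_ne_zero (by exact_mod_cast hη0.1.ne') hr0
  have : (ae φ).NeBot := ae_neBot.2 H.base_ne_zero
  obtain ⟨y, hy⟩ := (H.ae_green_lt_top measurable_one hr0 hfin).exists
  refine ne_of_gt ((pos_iff_ne_zero.2 hη0').trans_le
    (Hε.le_convergenceParameter_of_green_one (x := y) ?_))
  refine (green_hatPerturbed_le P ν ε hg (le_trans ?_ hη) y).trans_lt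
    (ENNReal.mul_lt_top (by simp) ((hmono y).trans_lt hy))
  rw [mul_assoc, mul_left_comm]
  gcongr with z
  exact hmono z

/-! ### Convexity of the logarithm of the convergence parameter -/

lemma lintegral_pow_hatKernel_le (K : Kernel S S) [IsSFiniteKernel K] {g₁ g₂ : S → ℝ}
    (h₁ : Measurable g₁) (h₂ : Measurable g₂) {s t : ℝ} (hs : 0 < s) (ht : 0 < t)
    (hst : s + t = 1) {u v : S → ℝ≥0∞} (hu : Measurable u) (hv : Measurable v) (n : ℕ) (x : S) :
    ∫⁻ y, u y ^ s * v y ^ t ∂(hatKernel (fun y => s * g₁ y + t * g₂ y) K ^ n) x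
      ≤ (∫⁻ y, u y ∂(hatKernel g₁ K ^ n) x) ^ s * (∫⁻ y, v y ∂(hatKernel g₂ K ^ n) x) ^ t := by
  have hg : Measurable fun y => s * g₁ y + t * g₂ y := (h₁.const_mul s).add (h₂.const_mul t)
  have huv : Measurable fun y => u y ^ s * v y ^ t := (hu.pow_const s).mul (hv.pow_const t)
  induction n generalizing x with
  | zero => rw [lintegral_pow_zero _ huv, lintegral_pow_zero _ hu, lintegral_pow_zero _ hv]
  | succ n ih =>
    rw [lintegral_pow_succ _ n huv, lintegral_pow_succ _ n hu, lintegral_pow_succ _ n hv]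
    refine (lintegral_mono ih).trans ?_
    have hU : Measurable fun y => ∫⁻ z, u z ∂(hatKernel g₁ K ^ n) y := hu.lintegral_kernel
    have hV : Measurable fun y => ∫⁻ z, v z ∂(hatKernel g₂ K ^ n) y := hv.lintegral_kernel
    rw [hatKernel_apply hg, hatKernel_apply h₁, hatKernel_apply h₂, lintegral_hatMeasure h₁ _ hU,
      lintegral_hatMeasure h₂ _ hV, lintegral_hatMeasure hg _ (u := fun y => _ ^ s * _ ^ t)
        ((hU.pow_const s).mul (hV.pow_const t))]
    refine le_trans (lintegral_mono fun y => le_of_eq ?_) (ENNReal.lintegral_mul_norm_pow_le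
      ((measurable_expWeight h₁).mul hU).aemeasurable
      ((measurable_expWeight h₂).mul hV).aemeasurable hs.le ht.le hst)
    rw [Pi.mul_apply, Pi.mul_apply,
      ENNReal.mul_rpow_of_nonneg _ _ hs.le, ENNReal.mul_rpow_of_nonneg _ _ ht.le,
      ENNReal.ofReal_rpow_of_pos (Real.exp_pos _), ENNReal.ofReal_rpow_of_pos (Real.exp_pos _),
      ← Real.exp_mul, ← Real.exp_mul, Real.exp_add, ENNReal.ofReal_mul (Real.exp_pos _).le,
      mul_comm s, mul_comm t]
    ring

lemma potential_hatKernel_le (K : Kernel S S) [IsSFiniteKernel K] {g₁ g₂ : S → ℝ}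
    (h₁ : Measurable g₁) (h₂ : Measurable g₂) {s t : ℝ} (hs : 0 < s) (ht : 0 < t)
    (hst : s + t = 1) (r₁ r₂ : ℝ≥0∞) (x : S) {A : Set S} (hA : MeasurableSet A) :
    potential (hatKernel (fun y => s * g₁ y + t * g₂ y) K) (r₁ ^ s * r₂ ^ t) x A
      ≤ potential (hatKernel g₁ K) r₁ x A ^ s * potential (hatKernel g₂ K) r₂ x A ^ t := by
  have hH := ENNReal.lintegral_mul_norm_pow_le (μ := (Measure.count : Measure ℕ))
    (f := fun n => r₁ ^ n * (hatKernel g₁ K ^ n) x A)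
    (g := fun n => r₂ ^ n * (hatKernel g₂ K ^ n) x A)
    (measurable_of_countable _).aemeasurable (measurable_of_countable _).aemeasurable
    hs.le ht.le hst
  simp only [lintegral_count] at hH
  refine le_trans (ENNReal.tsum_le_tsum fun n => ?_) hH
  have hA1 : Measurable (A.indicator (1 : S → ℝ≥0∞)) := measurable_one.indicator hA
  have h := lintegral_pow_hatKernel_le K h₁ h₂ hs ht hst hA1 hA1 n x
  have hind : (fun y => A.indicator (1 : S → ℝ≥0∞) y ^ s * A.indicator 1 y ^ t)
      = A.indicator 1 := by
    ext y
    by_cases hy : y ∈ A <;> simp [hy, hs, ht]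
  rw [hind] at h
  simp only [lintegral_indicator_one hA] at h
  rw [ENNReal.mul_rpow_of_nonneg _ _ hs.le, ENNReal.mul_rpow_of_nonneg _ _ ht.le]
  calc (r₁ ^ s * r₂ ^ t) ^ n * (hatKernel (fun y => s * g₁ y + t * g₂ y) K ^ n) x A
      ≤ (r₁ ^ s * r₂ ^ t) ^ n *
          ((hatKernel g₁ K ^ n) x A ^ s * (hatKernel g₂ K ^ n) x A ^ t) := by gcongr
    _ = _ := by
        have hpow : ∀ (r : ℝ≥0∞) (p : ℝ), (r ^ p) ^ n = (r ^ n) ^ p := fun r p => by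
          rw [← ENNReal.rpow_natCast, ← ENNReal.rpow_natCast, ← ENNReal.rpow_mul,
            ← ENNReal.rpow_mul, mul_comm]
        rw [mul_pow, hpow, hpow]
        ring

/-- Convexity of `log (1 / R)`. The two potentials of `C` are finite at a common state, as each of
them is finite `ν`-almost everywhere, the transforms of `ν` being equivalent to `ν`. -/
lemma logTheta_convex {ε : ℝ≥0} {g₁ g₂ : S → ℝ} (h₁ : Measurable g₁) (h₂ : Measurable g₂)
    (H₁ : Minorized φ (hatPerturbed P ν ε g₁) δ C (hatMeasure g₁ ν))
    (H₂ : Minorized φ (hatPerturbed P ν ε g₂) δ C (hatMeasure g₂ ν))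
    {s t : ℝ} (hs : 0 < s) (ht : 0 < t) (hst : s + t = 1) :
    logTheta φ P ν ε (fun y => s * g₁ y + t * g₂ y) ≤
      (s : EReal) * logTheta φ P ν ε g₁ + (t : EReal) * logTheta φ P ν ε g₂ := by
  have key : convergenceParameter φ (hatPerturbed P ν ε g₁) ^ s *
      convergenceParameter φ (hatPerturbed P ν ε g₂) ^ t ≤
      convergenceParameter φ (hatPerturbed P ν ε fun y => s * g₁ y + t * g₂ y) := by
    refine ENNReal.mul_le_of_forall_lt fun a ha b hb => ?_
    have ha' := (ENNReal.rpow_lt_rpow_iff (inv_pos.2 hs)).2 ha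
    have hb' := (ENNReal.rpow_lt_rpow_iff (inv_pos.2 ht)).2 hb
    rw [ENNReal.rpow_rpow_inv hs.ne'] at ha'
    rw [ENNReal.rpow_rpow_inv ht.ne'] at hb'
    have hC1 : Measurable (C.indicator (1 : S → ℝ≥0∞)) :=
      measurable_one.indicator H₁.measurableSet
    have hfin : ∀ {g : S → ℝ} {r : ℝ≥0∞}, Measurable g →
        ∫⁻ y, green (hatPerturbed P ν ε g) r (C.indicator 1) y ∂hatMeasure g ν < ⊤ →
        ∀ᵐ y ∂ν, potential (hatPerturbed P ν ε g) r y C < ⊤ := by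
      intro g r hg h
      have h0 := ae_lt_top (measurable_green _ _ hC1) h.ne
      have h0' : ∀ᵐ y ∂ν, green (hatPerturbed P ν ε g) r (C.indicator 1) y < ⊤ :=
        (withDensity_absolutelyContinuous' (measurable_expWeight hg).aemeasurable
          (Eventually.of_forall (expWeight_ne_zero g))).ae_le h0
      filter_upwards [h0'] with y hy
      rwa [potential_eq_green _ _ _ H₁.measurableSet]
    obtain ⟨x, hx1, hx2⟩ :=
      ((hfin h₁ (H₁.lintegral_green_lt_top_of_lt_convergenceParameter ha')).and
        (hfin h₂ (H₂.lintegral_green_lt_top_of_lt_convergenceParameter hb'))).exists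
    have hle := potential_hatKernel_le (perturbed P ν ε) h₁ h₂ hs ht hst (a ^ s⁻¹) (b ^ t⁻¹) x
      H₁.measurableSet
    rw [ENNReal.rpow_inv_rpow hs.ne', ENNReal.rpow_inv_rpow ht.ne'] at hle
    refine le_convergenceParameter H₁.measurableSet H₁.measure_ne_zero (lt_of_le_of_lt hle ?_)
    exact ENNReal.mul_lt_top (ENNReal.rpow_lt_top_of_nonneg hs.le hx1.ne)
      (ENNReal.rpow_lt_top_of_nonneg ht.le hx2.ne)
  simp only [logTheta, theta]
  rw [← ENNReal.log_rpow, ← ENNReal.log_rpow, ← ENNReal.log_mul_add, ENNReal.log_le_log_iff,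
    ENNReal.inv_rpow, ENNReal.inv_rpow, ← ENNReal.mul_inv
      (Or.inr (ENNReal.rpow_ne_top_of_nonneg ht.le H₂.convergenceParameter_ne_top))
      (Or.inl (ENNReal.rpow_ne_top_of_nonneg hs.le H₁.convergenceParameter_ne_top))]
  exact ENNReal.inv_le_inv.2 key

end

/-! ### Renewal at the regeneration times -/

namespace Minorized

variable {φ : Measure S} {K T : Kernel S S} {δ : ℝ≥0} {C : Set S} {μ : Measure S}

lemma measurable_indicator_const (H : Minorized φ K δ C μ) :
    Measurable (C.indicator fun _ => (δ : ℝ≥0∞)) :=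
  measurable_const.indicator H.measurableSet

lemma lintegral_eq_add (hT : ∀ x, K x = T x + C.indicator (fun _ => (δ : ℝ≥0∞)) x • μ)
    (u : S → ℝ≥0∞) (x : S) :
    ∫⁻ y, u y ∂K x = ∫⁻ y, u y ∂T x + C.indicator (fun _ => (δ : ℝ≥0∞)) x * ∫⁻ y, u y ∂μ := by
  rw [hT, lintegral_add_measure, lintegral_smul_measure, smul_eq_mul]

/-- The first-regeneration inequality between the Green functions of `K = T + δ 1_C ⊗ μ` and of
the taboo kernel `T`. -/
lemma green_add_le (H : Minorized φ K δ C μ)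
    (hT : ∀ x, K x = T x + C.indicator (fun _ => (δ : ℝ≥0∞)) x • μ) (s : ℝ≥0∞)
    {u : S → ℝ≥0∞} (hu : Measurable u) (x : S) :
    green T s u x + s * (∫⁻ y, green K s u y ∂μ) *
      green T s (C.indicator fun _ => (δ : ℝ≥0∞)) x ≤ green K s u x := by
  rw [← green_add_const_mul T s _ hu H.measurable_indicator_const]
  refine green_le_of_supersolution T s (hu.add (H.measurable_indicator_const.const_mul _))
    (fun z => le_of_eq ?_) x
  rw [green_eq K s hu z, lintegral_eq_add hT]
  simp only [Pi.add_apply]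
  ring

lemma mul_lintegral_green_le_one_of_lt (H : Minorized φ K δ C μ)
    (hT : ∀ x, K x = T x + C.indicator (fun _ => (δ : ℝ≥0∞)) x • μ) {s : ℝ≥0∞}
    (hs : s < convergenceParameter φ K) :
    s * ∫⁻ y, green T s (C.indicator fun _ => (δ : ℝ≥0∞)) y ∂μ ≤ 1 := by
  have hfin := H.lintegral_green_lt_top_of_lt_convergenceParameter hs
  have hC1 : Measurable (C.indicator (1 : S → ℝ≥0∞)) := measurable_one.indicator H.measurableSet
  set β := ∫⁻ y, green K s (C.indicator 1) y ∂μ with hβ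
  have hβ0 : β ≠ 0 := by
    refine ne_of_gt ((pos_iff_ne_zero.2 H.small_ne_zero).trans_le ?_)
    rw [hβ, ← lintegral_indicator_one H.measurableSet]
    refine lintegral_mono fun y => ?_
    rw [green_eq K s hC1]
    exact le_self_add
  have hle : s * β * ∫⁻ y, green T s (C.indicator fun _ => (δ : ℝ≥0∞)) y ∂μ ≤ β := by
    rw [← lintegral_const_mul _ (measurable_green T s H.measurable_indicator_const)]
    conv_rhs => rw [hβ]
    exact lintegral_mono fun y => le_add_self.trans (H.green_add_le hT s hC1 y)
  refine (ENNReal.mul_le_mul_iff_right hβ0 hfin.ne).1 ?_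
  calc _ = s * β * ∫⁻ y, green T s (C.indicator fun _ => (δ : ℝ≥0∞)) y ∂μ := by ring
    _ ≤ β * 1 := by rwa [mul_one]

/-- The weights `R^{n+1} μ Tⁿ δ 1_C` of the first regeneration time sum to at most one at the
convergence parameter, by letting the radius increase to it. -/
lemma mul_lintegral_green_le_one (H : Minorized φ K δ C μ)
    (hT : ∀ x, K x = T x + C.indicator (fun _ => (δ : ℝ≥0∞)) x • μ)
    (hR : convergenceParameter φ K ≠ 0) :
    convergenceParameter φ K * ∫⁻ y, green T (convergenceParameter φ K)
      (C.indicator fun _ => (δ : ℝ≥0∞)) y ∂μ ≤ 1 := by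
  rw [lintegral_green T _ H.measurable_indicator_const, ← ENNReal.tsum_mul_left]
  refine ENNReal.tsum_le_of_sum_range_le fun N => ?_
  have : (𝓝[<] convergenceParameter φ K).NeBot := nhdsLT_neBot_of_exists_lt
    ⟨0, pos_iff_ne_zero.2 hR⟩
  set a : ℕ → ℝ≥0∞ := fun n =>
    ∫⁻ x, ∫⁻ y, C.indicator (fun _ => (δ : ℝ≥0∞)) y ∂(T ^ n) x ∂μ with ha
  have ht : Tendsto (fun s : ℝ≥0∞ => ∑ n ∈ Finset.range N, s ^ (n + 1) * a n)
      (𝓝[<] convergenceParameter φ K)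
      (𝓝 (∑ n ∈ Finset.range N, convergenceParameter φ K ^ (n + 1) * a n)) := by
    refine tendsto_finsetSum _ fun n _ => ENNReal.Tendsto.mul_const ?_
      (Or.inl (pow_ne_zero _ hR))
    exact ((ENNReal.continuous_pow (n + 1)).tendsto _).mono_left nhdsWithin_le_nhds
  refine (le_of_eq (Finset.sum_congr rfl fun n _ => ?_)).trans
    (le_of_tendsto ht (eventually_mem_nhdsWithin.mono fun s hs => ?_))
  · rw [pow_succ']
    ring
  · refine le_trans ?_ (H.mul_lintegral_green_le_one_of_lt hT hs)
    rw [lintegral_green T _ H.measurable_indicator_const, ← ENNReal.tsum_mul_left]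
    refine le_trans (le_of_eq (Finset.sum_congr rfl fun n _ => ?_)) (ENNReal.sum_le_tsum _)
    rw [pow_succ']
    ring

/-- The function `r = ∑ₙ R^{n+1} Tⁿ δ 1_C` at the convergence parameter `R` of `K`. -/
noncomputable def regenFun (φ : Measure S) (K T : Kernel S S) (δ : ℝ≥0) (C : Set S) (x : S) :
    ℝ≥0∞ :=
  convergenceParameter φ K *
    green T (convergenceParameter φ K) (C.indicator fun _ => (δ : ℝ≥0∞)) x

lemma measurable_regenFun (H : Minorized φ K δ C μ) (T : Kernel S S) :
    Measurable (regenFun φ K T δ C) :=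
  (measurable_green T _ H.measurable_indicator_const).const_mul _

lemma lintegral_regenFun_le_one (H : Minorized φ K δ C μ)
    (hT : ∀ x, K x = T x + C.indicator (fun _ => (δ : ℝ≥0∞)) x • μ)
    (hR : convergenceParameter φ K ≠ 0) : ∫⁻ y, regenFun φ K T δ C y ∂μ ≤ 1 := by
  unfold regenFun
  rw [lintegral_const_mul _ (measurable_green T _ H.measurable_indicator_const)]
  exact H.mul_lintegral_green_le_one hT hR

lemma regenFun_add_eq (H : Minorized φ K δ C μ)
    (hT : ∀ x, K x = T x + C.indicator (fun _ => (δ : ℝ≥0∞)) x • μ) (x : S) :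
    regenFun φ K T δ C x + convergenceParameter φ K * C.indicator (fun _ => (δ : ℝ≥0∞)) x *
        ∫⁻ y, regenFun φ K T δ C y ∂μ
      = convergenceParameter φ K * C.indicator (fun _ => (δ : ℝ≥0∞)) x +
        convergenceParameter φ K * ∫⁻ y, regenFun φ K T δ C y ∂K x := by
  rw [lintegral_eq_add hT]
  have h : regenFun φ K T δ C x
      = convergenceParameter φ K * C.indicator (fun _ => (δ : ℝ≥0∞)) x +
        convergenceParameter φ K * ∫⁻ y, regenFun φ K T δ C y ∂T x := by
    unfold regenFun
    rw [lintegral_const_mul _ (measurable_green T _ H.measurable_indicator_const), ← mul_add,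
      ← green_eq T _ H.measurable_indicator_const]
  conv_lhs => rw [h]
  ring

lemma mul_indicator_ne_top (H : Minorized φ K δ C μ) (x : S) :
    convergenceParameter φ K * C.indicator (fun _ => (δ : ℝ≥0∞)) x ≠ ⊤ := by
  refine ENNReal.mul_ne_top H.convergenceParameter_ne_top ?_
  by_cases hx : x ∈ C <;> simp [hx]

lemma regenFun_superharmonic (H : Minorized φ K δ C μ)
    (hT : ∀ x, K x = T x + C.indicator (fun _ => (δ : ℝ≥0∞)) x • μ)
    (hR : convergenceParameter φ K ≠ 0) (x : S) :
    convergenceParameter φ K * ∫⁻ y, regenFun φ K T δ C y ∂K x ≤ regenFun φ K T δ C x := by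
  refine (ENNReal.add_le_add_iff_left (H.mul_indicator_ne_top x)).1 ?_
  rw [← H.regenFun_add_eq hT, add_comm]
  refine add_le_add_left ?_ _
  exact mul_le_of_le_one_right zero_le (H.lintegral_regenFun_le_one hT hR)

lemma regenFun_ne_zero (H : Minorized φ K δ C μ)
    (hT : ∀ x, K x = T x + C.indicator (fun _ => (δ : ℝ≥0∞)) x • μ)
    (hR : convergenceParameter φ K ≠ 0) (x : S) : regenFun φ K T δ C x ≠ 0 := by
  obtain ⟨n, hn⟩ := H.irreducible C H.measurableSet H.measure_ne_zero x
  have hle := pow_mul_lintegral_le_of_superharmonic K _ (H.measurable_regenFun T)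
    (H.regenFun_superharmonic hT hR) n x
  intro h0
  rw [h0, nonpos_iff_eq_zero, mul_eq_zero] at hle
  refine hle.elim (pow_ne_zero _ hR) fun h => ?_
  have hlow : convergenceParameter φ K * δ * (K ^ n) x C
      ≤ ∫⁻ y, regenFun φ K T δ C y ∂(K ^ n) x := by
    rw [← lintegral_indicator_const H.measurableSet]
    refine lintegral_mono fun y => ?_
    by_cases hy : y ∈ C
    · rw [Set.indicator_of_mem hy, regenFun, green_eq T _ H.measurable_indicator_const,
        Set.indicator_of_mem hy]
      gcongr
      exact le_self_add
    · rw [Set.indicator_of_notMem hy]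
      exact zero_le
  rw [h, nonpos_iff_eq_zero] at hlow
  exact mul_ne_zero (mul_ne_zero hR H.coe_ne_zero) hn hlow

lemma ae_regenFun_lt_top (H : Minorized φ K δ C μ)
    (hT : ∀ x, K x = T x + C.indicator (fun _ => (δ : ℝ≥0∞)) x • μ)
    (hR : convergenceParameter φ K ≠ 0) : ∀ᵐ x ∂φ, regenFun φ K T δ C x < ⊤ :=
  H.ae_lt_top_of_superharmonic (H.measurable_regenFun T) hR (H.regenFun_superharmonic hT hR)
    ((H.lintegral_regenFun_le_one hT hR).trans_lt ENNReal.one_lt_top)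

/-- In the recurrent case the first regeneration has total weight one. Otherwise a multiple of
`regenFun` would be a supersolution bounding the potential of `C`. -/
lemma lintegral_regenFun_eq_one (H : Minorized φ K δ C μ)
    (hT : ∀ x, K x = T x + C.indicator (fun _ => (δ : ℝ≥0∞)) x • μ)
    (hR : convergenceParameter φ K ≠ 0)
    (hrec : IsRecurrentAt φ K (convergenceParameter φ K)) :
    ∫⁻ y, regenFun φ K T δ C y ∂μ = 1 := by
  by_contra hne
  set R := convergenceParameter φ K with hRdef
  set q := ∫⁻ y, regenFun φ K T δ C y ∂μ with hq
  have hq1 : q < 1 := lt_of_le_of_ne (H.lintegral_regenFun_le_one hT hR) hne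
  set κ : ℝ≥0∞ := R * δ * (1 - q) with hκ
  have hκ0 : κ ≠ 0 := mul_ne_zero (mul_ne_zero hR H.coe_ne_zero) (tsub_pos_of_lt hq1).ne'
  have hκt : κ ≠ ⊤ := ENNReal.mul_ne_top (ENNReal.mul_ne_top H.convergenceParameter_ne_top
    ENNReal.coe_ne_top) (ne_top_of_le_ne_top ENNReal.one_ne_top tsub_le_self)
  have hC1 : Measurable (C.indicator (1 : S → ℝ≥0∞)) := measurable_one.indicator H.measurableSet
  have hsub : ∀ x, κ * C.indicator 1 x + R * ∫⁻ y, regenFun φ K T δ C y ∂K x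
      ≤ regenFun φ K T δ C x := by
    intro x
    have hfin : R * C.indicator (fun _ => (δ : ℝ≥0∞)) x * q ≠ ⊤ :=
      ENNReal.mul_ne_top (H.mul_indicator_ne_top x) (hq1.trans ENNReal.one_lt_top).ne
    refine (ENNReal.add_le_add_iff_right hfin).1 (le_of_eq ?_)
    rw [hq, hRdef, H.regenFun_add_eq hT x, ← hq, ← hRdef]
    by_cases hx : x ∈ C
    · simp only [Set.indicator_of_mem hx, Pi.one_apply, mul_one, hκ]
      rw [add_right_comm, ← mul_add, tsub_add_cancel_of_le hq1.le, mul_one]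
    · simp [hx]
  have : (ae φ).NeBot := ae_neBot.2 H.base_ne_zero
  obtain ⟨x, hx⟩ := (H.ae_regenFun_lt_top hT hR).exists
  have hgreen : green K R (C.indicator 1) x ≤ κ⁻¹ * regenFun φ K T δ C x := by
    refine green_le_of_supersolution K R (w := fun x => κ⁻¹ * regenFun φ K T δ C x) hC1
      (fun z => ?_) x
    rw [lintegral_const_mul _ (H.measurable_regenFun T)]
    calc C.indicator 1 z + R * (κ⁻¹ * ∫⁻ y, regenFun φ K T δ C y ∂K z)
        = κ⁻¹ * (κ * C.indicator 1 z + R * ∫⁻ y, regenFun φ K T δ C y ∂K z) := by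
          rw [mul_add, ← mul_assoc κ⁻¹, ENNReal.inv_mul_cancel hκ0 hκt]
          ring
      _ ≤ κ⁻¹ * regenFun φ K T δ C z := by
          gcongr
          exact hsub z
  have htop := hrec x C H.measurableSet (pos_iff_ne_zero.2 H.measure_ne_zero)
  rw [potential_eq_green K _ x H.measurableSet] at htop
  rw [htop, top_le_iff] at hgreen
  exact ENNReal.mul_ne_top (ENNReal.inv_ne_top.2 hκ0) hx.ne hgreen

lemma regenFun_harmonic (H : Minorized φ K δ C μ)
    (hT : ∀ x, K x = T x + C.indicator (fun _ => (δ : ℝ≥0∞)) x • μ)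
    (hR : convergenceParameter φ K ≠ 0)
    (hrec : IsRecurrentAt φ K (convergenceParameter φ K)) (x : S) :
    convergenceParameter φ K * ∫⁻ y, regenFun φ K T δ C y ∂K x = regenFun φ K T δ C x := by
  refine (ENNReal.add_right_inj (H.mul_indicator_ne_top x)).1 ?_
  rw [← H.regenFun_add_eq hT, add_comm, H.lintegral_regenFun_eq_one hT hR hrec, mul_one]

end Minorized

/-! ### The shifted kernel -/

lemma isFiniteMeasure_indicator_smul {ν : Measure S} {δ : ℝ≥0} {C : Set S} {g : S → ℝ}
    [IsFiniteMeasure (hatMeasure g ν)] (x : S) :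
    IsFiniteMeasure (C.indicator (fun _ => (δ : ℝ≥0∞)) x • hatMeasure g ν) := by
  refine Measure.smul_finite _ ?_
  by_cases hx : x ∈ C <;> simp [hx]

section

variable {P : Kernel S S} [IsMarkovKernel P] {φ ν : Measure S} [IsProbabilityMeasure ν]
  {δ : ℝ≥0} {C : Set S} {g : S → ℝ} {ε : ℝ≥0}

lemma indicator_smul_le (H : Minorized φ (hatPerturbed P ν ε g) δ C (hatMeasure g ν)) (x : S) :
    C.indicator (fun _ => (δ : ℝ≥0∞)) x • hatMeasure g ν ≤ hatPerturbed P ν ε g x := by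
  by_cases hx : x ∈ C
  · rw [Set.indicator_of_mem hx]
    exact H.smul_le x hx
  · rw [Set.indicator_of_notMem hx, zero_smul]
    exact Measure.zero_le _

/-- The measures `residual P ν δ C ε g x`, as a kernel. -/
noncomputable def residualKernel (H : Minorized φ (hatPerturbed P ν ε g) δ C (hatMeasure g ν))
    [IsFiniteMeasure (hatMeasure g ν)] : Kernel S S where
  toFun := residual P ν δ C ε g
  measurable' := by
    refine Measure.measurable_of_measurable_coe _ fun A hA => ?_
    have := isFiniteMeasure_indicator_smul (δ := δ) (C := C) (g := g) (ν := ν)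
    simp only [residual, Measure.sub_apply hA (indicator_smul_le H _), Measure.smul_apply,
      smul_eq_mul]
    exact (Kernel.measurable_coe _ hA).sub (H.measurable_indicator_const.mul_const _)

lemma hatPerturbed_eq_residualKernel_add
    (H : Minorized φ (hatPerturbed P ν ε g) δ C (hatMeasure g ν))
    [IsFiniteMeasure (hatMeasure g ν)] (x : S) :
    hatPerturbed P ν ε g x
      = residualKernel H x + C.indicator (fun _ => (δ : ℝ≥0∞)) x • hatMeasure g ν := by
  have := isFiniteMeasure_indicator_smul (δ := δ) (C := C) (g := g) (ν := ν) x
  exact (Measure.sub_add_cancel_of_le (indicator_smul_le H x)).symm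

lemma residualOp_iterate (H : Minorized φ (hatPerturbed P ν ε g) δ C (hatMeasure g ν))
    [IsFiniteMeasure (hatMeasure g ν)] {u : S → ℝ≥0∞} (hu : Measurable u) (n : ℕ) (x : S) :
    (residualOp P ν δ C ε g)^[n] u x = ∫⁻ y, u y ∂(residualKernel H ^ n) x := by
  induction n generalizing x with
  | zero => rw [lintegral_pow_zero _ hu, Function.iterate_zero, id]
  | succ n ih =>
    rw [Function.iterate_succ_apply', lintegral_pow_succ _ n hu]
    exact lintegral_congr ih

lemma rFun_eq_regenFun (H : Minorized φ (hatPerturbed P ν ε g) δ C (hatMeasure g ν))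
    [IsFiniteMeasure (hatMeasure g ν)] :
    rFun φ P ν δ C ε g
      = Minorized.regenFun φ (hatPerturbed P ν ε g) (residualKernel H) δ C := by
  ext x
  rw [rFun, Minorized.regenFun, green, ← ENNReal.tsum_mul_left]
  refine tsum_congr fun n => ?_
  rw [residualOp_iterate H H.measurable_indicator_const, theta, inv_inv, pow_succ']
  ring

lemma shifted_univ (hg : Measurable g) (hr : Measurable (rFun φ P ν δ C ε g)) (x : S) :
    shifted φ P ν δ C ε g x Set.univ
      = (∫⁻ y, rFun φ P ν δ C ε g y ∂hatPerturbed P ν ε g x) /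
        (theta φ P ν ε g * rFun φ P ν δ C ε g x) := by
  rw [shifted, withDensity_apply _ MeasurableSet.univ, setLIntegral_univ, hatPerturbed,
    hatKernel_apply hg, lintegral_hatMeasure hg _ hr]
  simp only [div_eq_mul_inv]
  rw [lintegral_mul_const (f := fun y => _ * rFun φ P ν δ C ε g y) _
    ((measurable_expWeight hg).mul hr)]

lemma ae_rFun_pos_lt_top_and_shifted_le_one
    (H : Minorized φ (hatPerturbed P ν ε g) δ C (hatMeasure g ν))
    [IsFiniteMeasure (hatMeasure g ν)] (hg : Measurable g)
    (hR : convergenceParameter φ (hatPerturbed P ν ε g) ≠ 0) :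
    ∀ᵐ x ∂φ, 0 < rFun φ P ν δ C ε g x ∧ rFun φ P ν δ C ε g x < ⊤ ∧
      shifted φ P ν δ C ε g x Set.univ ≤ 1 := by
  have hT := hatPerturbed_eq_residualKernel_add H
  have hr : Measurable (rFun φ P ν δ C ε g) := by
    rw [rFun_eq_regenFun H]
    exact H.measurable_regenFun _
  filter_upwards [H.ae_regenFun_lt_top hT hR] with x hx
  rw [← rFun_eq_regenFun H] at hx
  refine ⟨?_, hx, ?_⟩
  · rw [rFun_eq_regenFun H]
    exact pos_iff_ne_zero.2 (H.regenFun_ne_zero hT hR x)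
  · rw [shifted_univ hg hr]
    refine ENNReal.div_le_of_le_mul ?_
    have hsup := H.regenFun_superharmonic hT hR x
    rw [← rFun_eq_regenFun H] at hsup
    rw [one_mul, theta]
    calc ∫⁻ y, rFun φ P ν δ C ε g y ∂hatPerturbed P ν ε g x
        = (convergenceParameter φ (hatPerturbed P ν ε g))⁻¹ *
          (convergenceParameter φ (hatPerturbed P ν ε g) *
            ∫⁻ y, rFun φ P ν δ C ε g y ∂hatPerturbed P ν ε g x) := by
          rw [← mul_assoc, ENNReal.inv_mul_cancel hR H.convergenceParameter_ne_top, one_mul]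
      _ ≤ _ := by gcongr

lemma ae_isProbabilityMeasure_shifted
    (H : Minorized φ (hatPerturbed P ν ε g) δ C (hatMeasure g ν))
    [IsFiniteMeasure (hatMeasure g ν)] (hg : Measurable g)
    (hR : convergenceParameter φ (hatPerturbed P ν ε g) ≠ 0)
    (hrec : IsRecurrentAt φ (hatPerturbed P ν ε g) (theta φ P ν ε g)⁻¹) :
    ∀ᵐ x ∂φ, IsProbabilityMeasure (shifted φ P ν δ C ε g x) := by
  rw [theta, inv_inv] at hrec
  have hT := hatPerturbed_eq_residualKernel_add H
  have hr : Measurable (rFun φ P ν δ C ε g) := by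
    rw [rFun_eq_regenFun H]
    exact H.measurable_regenFun _
  filter_upwards [ae_rFun_pos_lt_top_and_shifted_le_one H hg hR] with x hx
  refine ⟨?_⟩
  have hharm := H.regenFun_harmonic hT hR hrec x
  rw [← rFun_eq_regenFun H] at hharm
  rw [shifted_univ hg hr, theta]
  conv_lhs => rw [← hharm]
  rw [← mul_assoc, ENNReal.inv_mul_cancel hR H.convergenceParameter_ne_top, one_mul]
  refine ENNReal.div_self ?_ ?_
  · intro h0
    rw [h0, mul_zero] at hharm
    exact hx.1.ne hharm
  · intro h0
    rw [h0, ENNReal.mul_top hR] at hharm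
    exact hx.2.1.ne hharm.symm

end

/-! ### The exponents `α f + β h` -/

lemma measurable_expo {f h : S → ℝ} (hf : Measurable f) (hh : Measurable h) (α : ℝ × ℝ) :
    Measurable (expo f h α) :=
  (hf.const_mul _).add (hh.const_mul _)

lemma exists_abs_expo_le {T : Type*} {f h : T → ℝ} (hh0 : ∀ x, 0 ≤ h x) (a b : ℝ) (α : ℝ × ℝ) :
    ∃ B, ∀ x ∈ levelSet h a, |f x| ≤ b → |expo f h α x| ≤ B := by
  refine ⟨|α.1| * b + |α.2| * a, fun x hx hb => ?_⟩
  refine (abs_add_le _ _).trans ?_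
  rw [abs_mul, abs_mul]
  gcongr
  rw [abs_of_nonneg (hh0 x)]
  exact hx

end MarkovAdditive

theorem proposition5p1 {S : Type*} [MeasurableSpace S]
    (P : Kernel S S) [IsMarkovKernel P]
    (φ : Measure S) [SigmaFinite φ]
    (hφ : MarkovAdditive.IsMaximalIrreducibilityMeasure φ P)
    (f h : S → ℝ) (hf : Measurable f) (hh : Measurable h) (hh0 : ∀ x, 0 ≤ h x)
    (a b : ℝ) (ha : 0 < a) (δ : ℝ≥0) (hδ : 0 < δ)
    (ν : Measure S) [IsProbabilityMeasure ν]
    (hC : 0 < φ (MarkovAdditive.levelSet h a))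
    (hνC : 0 < ν (MarkovAdditive.levelSet h a))
    (hM : ∀ x ∈ MarkovAdditive.levelSet h a, ∀ E : Set S, MeasurableSet E →
      (δ : ℝ≥0∞) * ν E ≤ P x E)
    (hν : ∀ᵐ x ∂ν, x ∈ MarkovAdditive.levelSet h a ∧ |f x| ≤ b) :
    -- (i)
    (∀ α : ℝ × ℝ, MarkovAdditive.InDomain P φ (MarkovAdditive.expo f h α) →
      (∀ᵐ x ∂φ, MarkovAdditive.gartnerEllis P (MarkovAdditive.expo f h α) (Measure.dirac x) =
        MarkovAdditive.gartnerEllis P (MarkovAdditive.expo f h α) ν) ∧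
      ∀ N : ℕ, 1 ≤ N →
        (⨆ n : ℕ, ⨆ _ : N ≤ n,
          ENNReal.log (MarkovAdditive.expMomentRegenOne P (MarkovAdditive.expo f h α) ν n) /
            (n : EReal)) < ⊤) ∧
    -- (ii)
    (∀ ε : ℝ≥0,
      (∀ α α' : ℝ × ℝ, ∀ s t : ℝ, 0 < s → 0 < t → s + t = 1 →
        MarkovAdditive.logTheta φ P ν ε (MarkovAdditive.expo f h (s • α + t • α')) ≤
          (s : EReal) * MarkovAdditive.logTheta φ P ν ε (MarkovAdditive.expo f h α) +
          (t : EReal) * MarkovAdditive.logTheta φ P ν ε (MarkovAdditive.expo f h α')) ∧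
      ∀ α : ℝ × ℝ, MarkovAdditive.InDomain P φ (MarkovAdditive.expo f h α) →
        ∀ᵐ x ∂φ, MarkovAdditive.logTheta φ P ν ε (MarkovAdditive.expo f h α) ≤
          MarkovAdditive.perturbedLimit P ν ε (MarkovAdditive.expo f h α) x) ∧
    -- (iii)
    (∀ α : ℝ × ℝ, MarkovAdditive.InDomain P φ (MarkovAdditive.expo f h α) →
      ∀ᵐ x ∂φ, Tendsto
        (fun ε : ℝ≥0 => MarkovAdditive.perturbedLimit P ν ε (MarkovAdditive.expo f h α) x)
        (𝓝[>] 0)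
        (𝓝 (MarkovAdditive.gartnerEllis P (MarkovAdditive.expo f h α) (Measure.dirac x)))) ∧
    -- (iv)
    (∀ α : ℝ, MarkovAdditive.InDomain P φ (fun x => α * f x) → ∀ ε : ℝ≥0,
      (∀ᵐ x ∂φ,
        0 < MarkovAdditive.rFun φ P ν δ (MarkovAdditive.levelSet h a) ε (fun x => α * f x) x ∧
        MarkovAdditive.rFun φ P ν δ (MarkovAdditive.levelSet h a) ε (fun x => α * f x) x < ⊤ ∧
        MarkovAdditive.shifted φ P ν δ (MarkovAdditive.levelSet h a) ε (fun x => α * f x) x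
          Set.univ ≤ 1) ∧
      (MarkovAdditive.IsRecurrentAt φ (MarkovAdditive.hatPerturbed P ν ε (fun x => α * f x))
          (MarkovAdditive.theta φ P ν ε (fun x => α * f x))⁻¹ →
        ∀ᵐ x ∂φ, IsProbabilityMeasure
          (MarkovAdditive.shifted φ P ν δ (MarkovAdditive.levelSet h a) ε
            (fun x => α * f x) x))) := by
  have hCm : MeasurableSet (MarkovAdditive.levelSet h a) := measurableSet_le hh measurable_const
  have hmin : ∀ {g : S → ℝ}, Measurable g → ∀ ε : ℝ≥0, MarkovAdditive.Minorized φ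
      (MarkovAdditive.hatPerturbed P ν ε g) δ (MarkovAdditive.levelSet h a)
      (MarkovAdditive.hatMeasure g ν) := fun hg ε =>
    MarkovAdditive.minorized_hatPerturbed hφ.1 hδ hCm hC hνC hM hg ε
  have hmin0 : ∀ {g : S → ℝ}, Measurable g → MarkovAdditive.Minorized φ
      (MarkovAdditive.hatKernel g P) δ (MarkovAdditive.levelSet h a)
      (MarkovAdditive.hatMeasure g ν) := fun hg => by
    simpa only [MarkovAdditive.hatPerturbed_zero P ν hg] using hmin hg 0
  have hbdd : ∀ α : ℝ × ℝ, ∃ B, ∀ᵐ x ∂ν, |MarkovAdditive.expo f h α x| ≤ B := fun α => by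
    obtain ⟨B, hB⟩ := MarkovAdditive.exists_abs_expo_le (f := f) hh0 a b α
    exact ⟨B, hν.mono fun x hx => hB x hx.1 hx.2⟩
  have hexpo := MarkovAdditive.measurable_expo hf hh
  refine ⟨fun α hα => ⟨?_, fun N hN => ?_⟩, fun ε => ⟨fun α α' s t hs ht hst => ?_,
    fun α _ => ?_⟩, fun α _ => ?_, fun α hα ε => ?_⟩
  · obtain ⟨B, hB⟩ := hbdd α
    exact MarkovAdditive.ae_gartnerEllis_eq (hmin0 (hexpo α)) (hexpo α) hB
  · exact MarkovAdditive.iSup_log_expMomentRegenOne_lt_top (hmin0 (hexpo α)) (hexpo α) hα hN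
  · have hcomb : MarkovAdditive.expo f h (s • α + t • α') = fun y =>
        s * MarkovAdditive.expo f h α y + t * MarkovAdditive.expo f h α' y := by
      ext y
      simp only [MarkovAdditive.expo, Prod.fst_add, Prod.snd_add, Prod.smul_fst, Prod.smul_snd,
        smul_eq_mul]
      ring
    rw [hcomb]
    exact MarkovAdditive.logTheta_convex (hexpo α) (hexpo α') (hmin (hexpo α) ε)
      (hmin (hexpo α') ε) hs ht hst
  · exact Eventually.of_forall fun x =>
      (hmin (hexpo α) ε).log_inv_convergenceParameter_le_growthRate x
  · exact MarkovAdditive.ae_tendsto_perturbedLimit (hmin0 (hexpo α)) (hexpo α)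
  · have hg : Measurable fun x => α * f x := hf.const_mul α
    obtain ⟨B, hB⟩ := hbdd (α, 0)
    have : IsFiniteMeasure (MarkovAdditive.hatMeasure (fun x => α * f x) ν) :=
      ⟨MarkovAdditive.hatMeasure_univ_lt_top (B := B) (by simpa [MarkovAdditive.expo] using hB)⟩
    have hR := MarkovAdditive.convergenceParameter_hatPerturbed_ne_zero (hmin0 hg) hg hα ε
      (hmin hg ε)
    exact ⟨MarkovAdditive.ae_rFun_pos_lt_top_and_shifted_le_one (hmin hg ε) hg hR,
      MarkovAdditive.ae_isProbabilityMeasure_shifted (hmin hg ε) hg hR⟩
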